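/- **Setting.** Let $\Omega\subset\mathbb R^3$ be open and bounded, $N\in\mathbb N$, $T_0>0$, $J=[0,T_0]$, $\hbar,m>0$, and let the real external potential $V$ be continuously differentiable on the closure of $\Omega\times(0,T_0)$. Let $H^1_0=H^1_0(\Omega;\mathbb C^N)$ be the closure of $C_c^\infty(\Omega;\mathbb C^N)$ in the norm $(\|f\|_{L^2}^2+\|\nabla f\|_{L^2}^2)^{1/2}$. As usual write $f\cdot g=\sum_k f_kg_k$ (without conjugation), $\nabla f\cdot\nabla g=\sum_k\nabla f_k\cdot\nabla g_k$, $|f|^2=\sum_k|f_k|^2$, $\mathrm{Re}(\bar\psi\omega)=\sum_k\mathrm{Re}(\overline{\psi_k}\,\omega_k)$, and, for $r$ extended by $0$ outside $\Omega$, $(W*r)(x)=\int_\Omega \frac{r(y)}{|x-y|}\,dy$. Let $F_n\subset H^1_0$ be a finite-dimensional complex subspace on which the pairing $\int_\Omega u\cdot v\,dx$ is nondegenerate: if $u\in F_n$ and $\int_\Omega u\cdot v\,dx=0$ for all $v\in F_n$, then $u=0$ (this is automatic when $F_n$ is closed under complex conjugation, for example when it has a real-valued basis). Let $Q_n$ be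 the $H^1_0$-orthogonal projection onto $F_n$, let $\Psi_0\in H^1_0$, and let $E_n=C(J;F_n)$ with norm $\sup_{t\in J}\|u(t)\|_{H^1_0}$. For $\psi\in E_n$ put $\rho=|\psi|^2$ and $$\mathcal G(t,u)[v]=\int_\Omega\Big\{\tfrac{\hbar^2}{2m}\nabla u\cdot\nabla v+\big(V(x,t)+(W*\rho(\cdot,t))(x)\big)\,u\cdot v\Big\}\,dx,\qquad u,v\in F_n .$$ The linear Faedo–Galerkin equation for $u:J\to F_n$ is $$i\hbar\int_\Omega \partial_tu(t)\cdot v\,dx=\mathcal G(t,u(t))[v]\qquad\text{for all }v\in F_n,\ t\in J.$$ The evolution operators $U^\rho_{\mathcal G}(t,s)$ on $F_n$ ($t,s\in J$) are its solution operators: for $x\in F_n$, $t\mapsto U^\rho_{\mathcal G}(t,s)x$ is the solution with value $x$ at $t=s$. They act on a linear functional $\ell$ on $F_n$ by $U^\rho_{\mathcal G}(t,s)\ell:=U^\rho_{\mathcal G}(t,s)g$, where $g\in F_n$ is the element with $\int_\Omega g\cdot v\,dx=\ell(v)$ for all $v\in F_n$; a function $h$ on $\Omega$ is regarded as the functional $v\mapsto\int_\Omega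 h\cdot v\,dx$. The numerical fixed point map $K_n:E_n\to E_n$ sends $\psi$ to the solution $u\in E_n$ of the linear Faedo–Galerkin equation with $\rho=|\psi|^2$ and $u(0)=Q_n\Psi_0$. **Proposition.** For every $\psi\in E_n$ the evolution operators $U^\rho_{\mathcal G}$ exist and are unique, $K_n$ is well defined, and the functionals in the formula below have their representing elements in $F_n$. The map $K_n$ is Gâteaux differentiable (over $\mathbb R$) at every $\psi\in E_n$, in every direction $\omega\in E_n$, with derivative $$K_n'[\psi](\omega)(t)=-\frac{2i}{\hbar}\int_0^tU^\rho_{\mathcal G}(t,s)\Big[\big(\mathrm{Re}(\bar\psi\omega)*W\big)(s)\;U^\rho_{\mathcal G}(s,0)Q_n\Psi_0\Big]\,ds,\qquad \rho=|\psi|^2,\ t\in J,$$ where the integrand is integrable. Each $K_n'[\psi]$ is a bounded real-linear operator on $E_n$, the map $\psi\mapsto K_n'[\psi]$ is continuous in the operator norm, and $K_n'[\psi]$ is the Fréchet derivative of $K_n$ at $\psi$; hence $K_n$ is continuously Fréchet differentiable on $E_n$. -/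

import Mathlib

open MeasureTheory Set
open scoped ComplexConjugate

noncomputable section

namespace Galerkin

/-- Physical space `ℝ³`. -/
abbrev Space : Type := EuclideanSpace ℝ (Fin 3)

/-- The Hilbert space `L²(Ω; ℂᴺ) × L²(Ω; ℂ^{N × 3})`, which holds the pairs `(f, ∇f)`.
Its norm is `‖(f, g)‖² = ‖f‖²_{L²} + ‖g‖²_{L²}`. -/
abbrev PairSpace (Ω : Set Space) (N : ℕ) : Type :=
  WithLp 2 (Lp (EuclideanSpace ℂ (Fin N)) 2 (volume.restrict Ω) ×
    Lp (EuclideanSpace ℂ (Fin N × Fin 3)) 2 (volume.restrict Ω))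

/-- The classical gradient of a function `φ : ℝ³ → ℂᴺ`; its entry `(k, i)` is `∂ᵢ φₖ`. -/
def classicalGrad {N : ℕ} (φ : Space → EuclideanSpace ℂ (Fin N)) (x : Space) :
    EuclideanSpace ℂ (Fin N × Fin 3) :=
  WithLp.toLp 2 fun p => fderiv ℝ φ x (EuclideanSpace.single p.2 (1 : ℝ)) p.1

/-- The pairs `(φ, ∇φ)` with `φ ∈ C_c^∞(Ω; ℂᴺ)`. -/
def testPairs (Ω : Set Space) (N : ℕ) : Set (PairSpace Ω N) :=
  {p | ∃ φ : Space → EuclideanSpace ℂ (Fin N),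
    ContDiff ℝ (⊤ : ℕ∞) φ ∧ HasCompactSupport φ ∧ tsupport φ ⊆ Ω ∧
    p.fst =ᵐ[volume.restrict Ω] φ ∧ p.snd =ᵐ[volume.restrict Ω] classicalGrad φ}

/-- `H¹₀(Ω; ℂᴺ)` as a closed subspace: the closure of `C_c^∞(Ω; ℂᴺ)` in the norm
`(‖f‖²_{L²} + ‖∇f‖²_{L²})^{1/2}`. An element is kept together with its weak gradient.
(`testPairs` is already a linear subspace, so the span adds nothing.) -/
def H10Submodule (Ω : Set Space) (N : ℕ) : Submodule ℂ (PairSpace Ω N) :=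
  (Submodule.span ℂ (testPairs Ω N)).topologicalClosure

/-- The complex Hilbert space `H¹₀(Ω; ℂᴺ)`, with `(f, g) = (f, g)_{L²} + (∇f, ∇g)_{L²}`. -/
def H10 (Ω : Set Space) (N : ℕ) : Type := H10Submodule Ω N

instance (Ω : Set Space) (N : ℕ) : NormedAddCommGroup (H10 Ω N) :=
  inferInstanceAs (NormedAddCommGroup (H10Submodule Ω N))

instance (Ω : Set Space) (N : ℕ) : InnerProductSpace ℂ (H10 Ω N) :=
  inferInstanceAs (InnerProductSpace ℂ (H10Submodule Ω N))

instance (Ω : Set Space) (N : ℕ) : CompleteSpace (H10 Ω N) :=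
  (Submodule.isClosed_topologicalClosure (Submodule.span ℂ (testPairs Ω N))).completeSpace_coe

/-- The inclusion of `H¹₀(Ω; ℂᴺ)` into the space of pairs, `f ↦ (f, ∇f)`. -/
def H10.toPair {Ω : Set Space} {N : ℕ} (f : H10 Ω N) : PairSpace Ω N := Subtype.val f

/-- The values of `f ∈ H¹₀(Ω; ℂᴺ)`. -/
def val {Ω : Set Space} {N : ℕ} (f : H10 Ω N) : Space → EuclideanSpace ℂ (Fin N) :=
  f.toPair.fst

/-- The weak gradient of `f ∈ H¹₀(Ω; ℂᴺ)`; its entry `(k, i)` is `∂ᵢ fₖ`. -/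
def grad {Ω : Set Space} {N : ℕ} (f : H10 Ω N) : Space → EuclideanSpace ℂ (Fin N × Fin 3) :=
  f.toPair.snd

/-- `f` is continuously differentiable on the closure of the open set `D`: it is differentiable
in `D`, and `f` and its derivative are continuous up to the boundary. -/
def IsC1OnClosure {X : Type*} [NormedAddCommGroup X] [NormedSpace ℝ X]
    (D : Set X) (f : X → ℝ) : Prop :=
  ContinuousOn f (closure D) ∧ ∃ f' : X → X →L[ℝ] ℝ,
    ContinuousOn f' (closure D) ∧ ∀ p ∈ D, HasFDerivAt f (f' p) p

/-- The convolution `W ∗ r` with `W(x) = 1/|x|`, where `r` is extended by zero outside `Ω`. -/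
def hartree (Ω : Set Space) (r : Space → ℝ) (x : Space) : ℝ :=
  ∫ y in Ω, ‖x - y‖⁻¹ * r y

/-- The charge density `ρ = |ψ|² = ∑ₖ |ψₖ|²`. -/
def density {Ω : Set Space} {N : ℕ} (ψ : H10 Ω N) (y : Space) : ℝ :=
  ∑ k, ‖val ψ y k‖ ^ 2

/-- `Re(ψ̄ ω) = ∑ₖ Re(ψ̄ₖ ωₖ)`. -/
def reProduct {Ω : Set Space} {N : ℕ} (ψ ω : H10 Ω N) (y : Space) : ℝ :=
  ∑ k, (conj (val ψ y k) * val ω y k).re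

/-- The bilinear pairing `∫_Ω f g = ∑ₖ ∫_Ω fₖ gₖ dx` (no conjugation). -/
def pairing {Ω : Set Space} {N : ℕ} (f g : H10 Ω N) : ℂ :=
  ∫ x in Ω, ∑ k, val f x k * val g x k

/-- The functional `v ↦ ∫_Ω q u v dx` for a real multiplier `q`. -/
def multiplierForm {Ω : Set Space} {N : ℕ} (q : Space → ℝ) (u v : H10 Ω N) : ℂ :=
  ∫ x in Ω, (q x : ℂ) * ∑ k, val u x k * val v x k

/-- The time interval `J = [0, T]`. -/
abbrev TimeInterval (T : ℝ) : Type := Icc (0 : ℝ) T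

/-- The initial time `0 ∈ J`. -/
def startTime {T : ℝ} (hT : 0 < T) : TimeInterval T := ⟨0, le_refl 0, hT.le⟩

/-- The space `E_n` over the finite-dimensional space `F`: continuous functions `J → F` with
the norm `sup_t ‖u(t)‖_{H¹₀}`. -/
abbrev PathSpace {Ω : Set Space} {N : ℕ} (T : ℝ) (F : Submodule ℂ (H10 Ω N)) : Type :=
  C(TimeInterval T, F)

/-- The elements of `PathSpace T F` are the functions `∑ⱼ αⱼ(t) fⱼ` with `αⱼ ∈ C(J)`, for any
basis `fⱼ` of `F`. -/
theorem pathSpace_eq_sum {Ω : Set Space} {N : ℕ} {T : ℝ} {F : Submodule ℂ (H10 Ω N)} {k : ℕ}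
    (f : Module.Basis (Fin k) ℂ F) (u : TimeInterval T → F) :
    Continuous u ↔ ∃ α : Fin k → C(TimeInterval T, ℂ), ∀ t, u t = ∑ j, α j t • f j := by
  have : FiniteDimensional ℂ F := f.finiteDimensional_of_finite
  constructor
  · intro hu
    refine ⟨fun j => ⟨fun t => f.coord j (u t),
      (LinearMap.continuous_of_finiteDimensional (f.coord j)).comp hu⟩, fun t => ?_⟩
    simp [f.sum_repr (u t)]
  · rintro ⟨α, hα⟩
    rw [funext hα]
    fun_prop

/-- The Galerkin form
`𝒢(t, u)[v] = ∫_Ω (ħ²/2m) ∇u · ∇v + (V(x, t) + W ∗ ρ) u v dx`, `ρ = |ψ(t)|²`. -/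
def galerkinForm {Ω : Set Space} {N : ℕ} {T : ℝ} (hbar m : ℝ) (V : Space × ℝ → ℝ)
    {F : Submodule ℂ (H10 Ω N)} (ψ : PathSpace T F) (t : TimeInterval T) (u v : F) : ℂ :=
  ∫ x in Ω, ((hbar ^ 2 / (2 * m) : ℝ) : ℂ) *
      (∑ p : Fin N × Fin 3, grad (u : H10 Ω N) x p * grad (v : H10 Ω N) x p) +
    ((V (x, (t : ℝ)) + hartree Ω (density (ψ t : H10 Ω N)) x : ℝ) : ℂ) *
      ∑ k, val (u : H10 Ω N) x k * val (v : H10 Ω N) x k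

/-- `u : J → F` solves the linear Faedo-Galerkin equation `iħ ∂u/∂t = 𝒢(t, u)` on `J`, with
`ρ = |ψ|²` in the potential. The derivative `∂u/∂t` (one-sided at the two ends of `J`) acts on
`v ∈ F` by `⟨∂u/∂t, v⟩ = ∫_Ω (∂u/∂t) v dx`. -/
def SolvesGalerkin {Ω : Set Space} {N : ℕ} {T : ℝ} (hT : 0 < T) (hbar m : ℝ)
    (V : Space × ℝ → ℝ) {F : Submodule ℂ (H10 Ω N)} (ψ : PathSpace T F)
    (u : TimeInterval T → F) : Prop :=
  ∀ t : TimeInterval T, ∃ u' : F,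
    HasDerivWithinAt (fun s : ℝ => u (projIcc 0 T hT.le s)) u' (Icc 0 T) (t : ℝ) ∧
    ∀ v : F, Complex.I * (hbar : ℂ) * pairing (u' : H10 Ω N) (v : H10 Ω N) =
      galerkinForm hbar m V ψ t (u t) v

/-- `u ∈ E_n` solves the linear Faedo-Galerkin problem with `ρ = |ψ|²` and
`u(0) = Q Ψ₀`, where `Q` is the `H¹₀`-orthogonal projection onto `F`. -/
def IsGalerkinSolution {Ω : Set Space} {N : ℕ} {T : ℝ} (hT : 0 < T) (hbar m : ℝ)
    (V : Space × ℝ → ℝ) {F : Submodule ℂ (H10 Ω N)} [FiniteDimensional ℂ F] (Ψ₀ : H10 Ω N)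
    (ψ u : PathSpace T F) : Prop :=
  SolvesGalerkin hT hbar m V ψ u ∧ u (startTime hT) = F.orthogonalProjectionOnto Ψ₀

/-- The numerical fixed point map `K_n`, which sends `ψ` to the solution of the linear
Faedo-Galerkin problem with `ρ = |ψ|²`. -/
def numericalMap {Ω : Set Space} {N : ℕ} {T : ℝ} (hT : 0 < T) (hbar m : ℝ)
    (V : Space × ℝ → ℝ) {F : Submodule ℂ (H10 Ω N)} [FiniteDimensional ℂ F] (Ψ₀ : H10 Ω N)
    (ψ : PathSpace T F) : PathSpace T F :=
  Classical.epsilon fun u => IsGalerkinSolution hT hbar m V Ψ₀ ψ u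

/-- `U(t, s)` is the family of solution operators of the linear Faedo-Galerkin equation with
`ρ = |ψ|²`: for every `s ∈ J` and `x ∈ F`, `t ↦ U(t, s) x` is a solution with value `x` at `s`. -/
def IsGalerkinEvolution {Ω : Set Space} {N : ℕ} {T : ℝ} (hT : 0 < T) (hbar m : ℝ)
    (V : Space × ℝ → ℝ) {F : Submodule ℂ (H10 Ω N)} (ψ : PathSpace T F)
    (U : TimeInterval T → TimeInterval T → F →L[ℂ] F) : Prop :=
  ∀ (s : TimeInterval T) (x : F),
    U s s x = x ∧ SolvesGalerkin hT hbar m V ψ fun t => U t s x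

/-- The Faedo-Galerkin evolution operators `U_𝒢^ρ(t, s)` with `ρ = |ψ|²`. -/
def galerkinEvolution {Ω : Set Space} {N : ℕ} {T : ℝ} (hT : 0 < T) (hbar m : ℝ)
    (V : Space × ℝ → ℝ) {F : Submodule ℂ (H10 Ω N)} (ψ : PathSpace T F) :
    TimeInterval T → TimeInterval T → F →L[ℂ] F :=
  Classical.epsilon fun U => IsGalerkinEvolution hT hbar m V ψ U

/-- The element `g ∈ F` that represents the functional `ℓ` on `F`: `∫_Ω g v dx = ℓ(v)` for all
`v ∈ F`. Through it the evolution operators act on the dual of `F`. -/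
def representative {Ω : Set Space} {N : ℕ} {F : Submodule ℂ (H10 Ω N)} (l : F → ℂ) : F :=
  Classical.epsilon fun g : F => ∀ v : F, pairing (g : H10 Ω N) (v : H10 Ω N) = l v

/-- The functional `v ↦ ∫_Ω (Re(ψ̄(s) ω(s)) ∗ W) (U_𝒢^ρ(s, 0) Q Ψ₀) v dx` on `F`. -/
def hartreeFunctional {Ω : Set Space} {N : ℕ} {T : ℝ} (hT : 0 < T) (hbar m : ℝ)
    (V : Space × ℝ → ℝ) {F : Submodule ℂ (H10 Ω N)} [FiniteDimensional ℂ F] (Ψ₀ : H10 Ω N)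
    (ψ ω : PathSpace T F) (s : TimeInterval T) (v : F) : ℂ :=
  multiplierForm (hartree Ω (reProduct (ψ s : H10 Ω N) (ω s : H10 Ω N)))
    (galerkinEvolution hT hbar m V ψ s (startTime hT) (F.orthogonalProjectionOnto Ψ₀) : F)
    (v : H10 Ω N)

/-- The integrand `U_𝒢^ρ(t, s) [Re(ψ̄ ω) ∗ W] U_𝒢^ρ(s, 0) Q Ψ₀` of the derivative formula, the
product in the middle being taken as an element of the dual of `F`. -/
def derivIntegrand {Ω : Set Space} {N : ℕ} {T : ℝ} (hT : 0 < T) (hbar m : ℝ)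
    (V : Space × ℝ → ℝ) {F : Submodule ℂ (H10 Ω N)} [FiniteDimensional ℂ F] (Ψ₀ : H10 Ω N)
    (ψ ω : PathSpace T F) (t s : TimeInterval T) : F :=
  galerkinEvolution hT hbar m V ψ t s
    (representative (hartreeFunctional hT hbar m V Ψ₀ ψ ω s))

end Galerkin

end

open MeasureTheory Set
open scoped ComplexConjugate

noncomputable section

namespace Galerkin

/-! On the finite-dimensional space F the nondegenerate pairing identifies F with its dual, so the
Faedo-Galerkin equation is a linear ODE u' = (a₀ + H(ψ, ψ)) u. Here a₀ carries the kinetic term and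
V, and H(f, g) comes from the potential Re(f̄ g) ∗ W. It is symmetric and only real-bilinear because
of the conjugation, hence calculus over ℝ. The potential is bounded: elements of H¹₀ lie in L⁴
(`memLp_four_val`), so Re(f̄ g) is in L², and the Newton kernel is locally square integrable in
dimension three (`memLp_top_hartree`).

In integrated form the ODE reads (1 - L a) u = x₀, where L a is u ↦ ∫₀ᵗ a u. Iterates of L a decay
factorially, so 1 - L a is invertible for every a, with no smallness of T. Inversion is smooth on
the units of a Banach algebra and a is quadratic in ψ, so the solution is C¹ in ψ
(`contDiff_oneSubInverse`, `contDiff_solutionMap`). Fréchet differentiability thus comes directly,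
and the Gâteaux derivative is a consequence.

The derivative w in direction ω solves w' = a w + 2 H(ψ, ω) u, w(0) = 0. Variation of constants with
U(t, s) = p(t) q(s), where p is a fundamental solution and q its inverse, gives the formula. The
operator H contains 1/(iħ), and 2/(iħ) = -2i/ħ. -/

/-- Bounded real-bilinear maps, with the topologies of the norms. -/
abbrev BoundedBilin (X Y Z : Type*) [NormedAddCommGroup X] [NormedSpace ℝ X]
    [NormedAddCommGroup Y] [NormedSpace ℝ Y] [NormedAddCommGroup Z] [NormedSpace ℝ Z] : Type _ :=
  X →L[ℝ] Y →L[ℝ] Z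

/-! ### Smooth dependence of (1 - L a)⁻¹ w on a -/

section Resolvent

variable {X W : Type*} [NormedAddCommGroup X] [NormedSpace ℝ X] [NormedAddCommGroup W]
  [NormedSpace ℝ W] [CompleteSpace W]

/-- The factorisation 1 - Sⁿ = (1 - S)(1 + S + ⋯ + Sⁿ⁻¹) has commuting factors, and 1 - Sⁿ is a unit
by the Neumann series; hence so is 1 - S, although S itself need not be a contraction. -/
theorem isUnit_one_sub_of_iterate_le {S : W →L[ℝ] W} {n : ℕ}
    (hn : ∀ f, ‖S^[n] f‖ ≤ 1 / 2 * ‖f‖) : IsUnit (1 - S) := by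
  have hnorm : ‖S ^ n‖ < 1 := by
    refine lt_of_le_of_lt (ContinuousLinearMap.opNorm_le_bound _ (by norm_num : (0 : ℝ) ≤ 1 / 2)
      fun f => ?_) (by norm_num : (1 / 2 : ℝ) < 1)
    rw [FunLike.coe_pow_eq_iterate]
    exact hn f
  have h1 : IsUnit (1 - S ^ n) := isUnit_one_sub_of_norm_lt_one (R := W →L[ℝ] W) hnorm
  rw [← mul_neg_geom_sum] at h1
  refine ((Commute.isUnit_mul_iff ?_).mp h1).1
  exact (Commute.sum_right _ _ _ fun i _ =>
    ((Commute.one_left _).sub_left (Commute.refl _)).pow_right i)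

/-- `(1 - L a)⁻¹ w`. -/
def oneSubInverse (L : BoundedBilin X W W) (w : W) (a : X) : W := Ring.inverse (1 - L a) w

variable {L : BoundedBilin X W W} (hL : ∀ a, ∃ n : ℕ, ∀ f, ‖(L a)^[n] f‖ ≤ 1 / 2 * ‖f‖)
include hL

theorem isUnit_one_sub_apply (a : X) : IsUnit (1 - L a) :=
  isUnit_one_sub_of_iterate_le (hL a).choose_spec

theorem eq_oneSubInverse_iff (w u : W) (a : X) : u = oneSubInverse L w a ↔ u - L a u = w := by
  have hU := isUnit_one_sub_apply hL a
  have h1 : (1 - L a) u = u - L a u := rfl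
  rw [← h1, oneSubInverse]
  constructor
  · rintro rfl
    rw [← mul_apply_eq_comp, Ring.mul_inverse_cancel _ hU, one_apply_eq_self]
  · intro h
    rw [← h, ← mul_apply_eq_comp, Ring.inverse_mul_cancel _ hU, one_apply_eq_self]

/-- Inversion is smooth near each unit, and a ↦ 1 - L a is affine with unit values. -/
theorem contDiff_oneSubInverse (w : W) : ContDiff ℝ 1 (oneSubInverse L w) := by
  unfold oneSubInverse
  refine ContDiff.clm_apply ?_ contDiff_const
  rw [contDiff_iff_contDiffAt]
  intro a
  obtain ⟨v, hv⟩ := isUnit_one_sub_apply hL a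
  have h := contDiffAt_ringInverse ℝ (n := 1) (R := W →L[ℝ] W) v
  rw [hv] at h
  exact ContDiffAt.comp a h (contDiff_const.sub L.contDiff).contDiffAt

/-- Differentiate the identity u(a) - L a u(a) = w in a: the derivative v satisfies v - L a v = L b
u(a), an equation of the same type. -/
theorem fderiv_oneSubInverse (w : W) (a b : X) :
    fderiv ℝ (oneSubInverse L w) a b = oneSubInverse L (L b (oneSubInverse L w a)) a := by
  rw [eq_oneSubInverse_iff hL]
  have hd : HasFDerivAt (oneSubInverse L w) _ a :=
    ((contDiff_oneSubInverse hL w).differentiable one_ne_zero a).hasFDerivAt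
  have h := hd.sub (L.hasFDerivAt.clm_apply hd)
  have hc : (oneSubInverse L w - fun a => L a (oneSubInverse L w a)) = fun _ => w := by
    ext1 a
    exact (eq_oneSubInverse_iff hL w _ a).mp rfl
  rw [hc] at h
  have h0 := congrArg (fun L => L b) (h.unique (hasFDerivAt_const _ a))
  simp only [sub_apply, add_apply, ContinuousLinearMap.comp_apply, zero_apply,
    ContinuousLinearMap.flip_apply] at h0
  rw [← sub_eq_zero, ← h0, sub_add_eq_sub_sub]

end Resolvent

/-! ### Linear ODEs on J as Volterra equations -/

section LinearODE

variable {X Y Z E : Type*} [NormedAddCommGroup X] [NormedSpace ℝ X] [NormedAddCommGroup Y]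
  [NormedSpace ℝ Y] [NormedAddCommGroup Z] [NormedSpace ℝ Z] [NormedAddCommGroup E]
  [NormedSpace ℝ E]

/-- The pointwise action of a bounded bilinear map on continuous functions. -/
def liftBilin (J : Type*) [TopologicalSpace J] [CompactSpace J] (B : BoundedBilin X Y Z) :
    BoundedBilin C(J, X) C(J, Y) C(J, Z) :=
  LinearMap.mkContinuous₂
    (LinearMap.mk₂ ℝ (fun f g => (⟨fun t => B (f t) (g t), by fun_prop⟩ : C(J, Z)))
      (fun f f' g => by ext t; simp) (fun c f g => by ext t; simp)
      (fun f g g' => by ext t; simp) (fun c f g => by ext t; simp)) ‖B‖ (fun f g => by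
        rw [ContinuousMap.norm_le _ (by positivity)]
        intro t
        calc ‖B (f t) (g t)‖ ≤ ‖B‖ * ‖f t‖ * ‖g t‖ := B.le_opNorm₂ _ _
          _ ≤ ‖B‖ * ‖f‖ * ‖g‖ := by
            gcongr
            · exact f.norm_coe_le_norm t
            · exact g.norm_coe_le_norm t)

@[simp]
theorem liftBilin_apply {J : Type*} [TopologicalSpace J] [CompactSpace J]
    (B : BoundedBilin X Y Z) (f : C(J, X)) (g : C(J, Y)) (t : J) :
    liftBilin J B f g t = B (f t) (g t) := rfl

variable {T : ℝ} (hT : 0 < T)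

/-- The extension of a function on `J` to the real line by its boundary values. -/
def extend (u : TimeInterval T → E) (s : ℝ) : E := u (projIcc 0 T hT.le s)

omit [NormedAddCommGroup E] [NormedSpace ℝ E] in
theorem extend_apply (u : TimeInterval T → E) (t : TimeInterval T) :
    extend hT u (t : ℝ) = u t := by
  rw [extend, projIcc_val]

omit [NormedSpace ℝ E] in
theorem continuous_extend {u : TimeInterval T → E} (hu : Continuous u) :
    Continuous (extend hT u) :=
  hu.comp continuous_projIcc

theorem eq_startTime_of_hasDerivWithinAt_zero {u : TimeInterval T → E}
    (h : ∀ t : TimeInterval T, HasDerivWithinAt (extend hT u) 0 (Icc 0 T) (t : ℝ))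
    (t : TimeInterval T) : u t = u (startTime hT) := by
  have := constant_of_derivWithin_zero (f := extend hT u) (a := 0) (b := T)
    (fun t ht => (h ⟨t, ht⟩).differentiableWithinAt)
    (fun t ht => (h ⟨t, Ico_subset_Icc_self ht⟩).derivWithin
      (uniqueDiffOn_Icc hT t (Ico_subset_Icc_self ht))) t t.2
  rw [extend_apply] at this
  rw [this]
  exact extend_apply hT u (startTime hT)

variable [CompleteSpace E]

theorem hasDerivAt_integral_extend (f : C(TimeInterval T, E)) (t : ℝ) :
    HasDerivAt (fun r => ∫ s in (0 : ℝ)..r, extend hT f s) (extend hT f t) t :=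
  intervalIntegral.integral_hasDerivAt_right
    ((continuous_extend hT f.continuous).intervalIntegrable _ _)
    ((continuous_extend hT f.continuous).stronglyMeasurableAtFilter _ _)
    (continuous_extend hT f.continuous).continuousAt

omit [CompleteSpace E] in
theorem norm_integral_extend_le (f : C(TimeInterval T, E)) (t : TimeInterval T) :
    ‖∫ s in (0 : ℝ)..t, extend hT f s‖ ≤ T * ‖f‖ := by
  have := intervalIntegral.norm_integral_le_of_norm_le_const (a := 0) (b := (t : ℝ))
    (f := extend hT f) (C := ‖f‖) (fun s _ => f.norm_coe_le_norm _)
  refine this.trans ?_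
  rw [mul_comm, sub_zero, abs_of_nonneg t.2.1]
  exact mul_le_mul_of_nonneg_right t.2.2 (norm_nonneg _)

/-- The Volterra operator `f ↦ ∫₀ᵗ f`. -/
def volterra : C(TimeInterval T, E) →L[ℝ] C(TimeInterval T, E) :=
  LinearMap.mkContinuous
    { toFun := fun f => ⟨fun t => ∫ s in (0 : ℝ)..t, extend hT f s,
        (continuous_iff_continuousAt.mpr fun t =>
          (hasDerivAt_integral_extend hT f t).continuousAt).comp continuous_subtype_val⟩
      map_add' := fun f g => by
        ext t
        exact intervalIntegral.integral_add
          ((continuous_extend hT f.continuous).intervalIntegrable _ _)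
          ((continuous_extend hT g.continuous).intervalIntegrable _ _)
      map_smul' := fun c f => by
        ext t
        exact intervalIntegral.integral_smul c _ } T
    (fun f => (ContinuousMap.norm_le _ (by positivity)).mpr (norm_integral_extend_le hT f))

theorem volterra_apply (f : C(TimeInterval T, E)) (t : TimeInterval T) :
    volterra hT f t = ∫ s in (0 : ℝ)..t, extend hT f s := rfl

theorem volterra_startTime (f : C(TimeInterval T, E)) : volterra hT f (startTime hT) = 0 := by
  rw [volterra_apply]
  exact intervalIntegral.integral_same

theorem hasDerivWithinAt_volterra (f : C(TimeInterval T, E)) (t : TimeInterval T) :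
    HasDerivWithinAt (extend hT (volterra hT f)) (f t) (Icc 0 T) (t : ℝ) := by
  have := (hasDerivAt_integral_extend hT f t).hasDerivWithinAt (s := Icc 0 T)
  rw [extend_apply] at this
  refine this.congr_of_mem (fun s hs => ?_) t.2
  rw [extend, volterra_apply, projIcc_of_mem hT.le hs]

/-- The fundamental theorem of calculus in both directions, with one-sided derivatives at the ends
of J. It trades initial value problems for fixed point equations. -/
theorem eq_const_add_volterra_iff (u f : C(TimeInterval T, E)) (x : E) :
    u = ContinuousMap.const _ x + volterra hT f ↔ u (startTime hT) = x ∧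
      ∀ t : TimeInterval T, HasDerivWithinAt (extend hT u) (f t) (Icc 0 T) (t : ℝ) := by
  constructor
  · rintro rfl
    refine ⟨by simp [volterra_startTime], fun t => ?_⟩
    exact (hasDerivWithinAt_volterra hT f t).const_add x
  · rintro ⟨h0, h⟩
    have := eq_startTime_of_hasDerivWithinAt_zero hT (u := fun t => u t - volterra hT f t)
      (fun t => by
      rw [← sub_self (f t)]
      exact (h t).sub (hasDerivWithinAt_volterra hT f t))
    ext t
    have ht := this t
    simp only [volterra_startTime, sub_zero, h0] at ht
    simp [← ht]

/-- The operator `u ↦ ∫₀ᵗ a u`, as a function of the coefficient `a`. -/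
def integralOperator :
    BoundedBilin C(TimeInterval T, E →L[ℝ] E) C(TimeInterval T, E) C(TimeInterval T, E) :=
  (ContinuousLinearMap.compL ℝ _ _ _ (volterra hT)) ∘L
    liftBilin (TimeInterval T) (ContinuousLinearMap.id ℝ (E →L[ℝ] E))

theorem integralOperator_apply (a : C(TimeInterval T, E →L[ℝ] E)) (u : C(TimeInterval T, E)) :
    integralOperator hT a u =
      volterra hT (liftBilin (TimeInterval T) (ContinuousLinearMap.id ℝ (E →L[ℝ] E)) a u) := rfl

/-- The bound must keep its dependence on t: integrating sⁿ over [0, t] is what produces the next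
factor of the factorial. -/
theorem norm_integralOperator_iterate_le (a : C(TimeInterval T, E →L[ℝ] E)) (n : ℕ)
    (f : C(TimeInterval T, E)) (t : TimeInterval T) :
    ‖(integralOperator hT a)^[n] f t‖ ≤ (‖a‖ * t) ^ n / n.factorial * ‖f‖ := by
  induction n generalizing t with
  | zero => simpa using f.norm_coe_le_norm t
  | succ n ih =>
    rw [Function.iterate_succ_apply', integralOperator_apply, volterra_apply]
    have hb : ∀ s ∈ Ioc (0 : ℝ) t, ‖extend hT (liftBilin (TimeInterval T)
        (ContinuousLinearMap.id ℝ (E →L[ℝ] E)) a ((integralOperator hT a)^[n] f)) s‖ ≤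
        ‖a‖ * ((‖a‖ * s) ^ n / n.factorial * ‖f‖) := by
      intro s hs
      have hs' : s ∈ Icc 0 T := ⟨hs.1.le, hs.2.trans t.2.2⟩
      rw [extend, projIcc_of_mem hT.le hs', liftBilin_apply]
      refine (ContinuousLinearMap.le_opNorm _ _).trans ?_
      gcongr
      · exact a.norm_coe_le_norm _
      · exact ih ⟨s, hs'⟩
    refine (intervalIntegral.norm_integral_le_of_norm_le t.2.1
      (Filter.Eventually.of_forall hb)
      (Continuous.intervalIntegrable (by fun_prop) _ _)).trans (le_of_eq ?_)
    have : ∀ s : ℝ, ‖a‖ * ((‖a‖ * s) ^ n / n.factorial * ‖f‖) =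
        (‖a‖ ^ (n + 1) / n.factorial * ‖f‖) * s ^ n := fun s => by rw [mul_pow]; ring
    simp_rw [this]
    rw [intervalIntegral.integral_const_mul, integral_pow, Nat.factorial_succ, mul_pow]
    push_cast
    have : (n.factorial : ℝ) ≠ 0 := by positivity
    field_simp
    simp

theorem exists_norm_integralOperator_iterate_le (a : C(TimeInterval T, E →L[ℝ] E)) :
    ∃ n : ℕ, ∀ f, ‖(integralOperator hT a)^[n] f‖ ≤ 1 / 2 * ‖f‖ := by
  obtain ⟨n, hn⟩ := ((FloorSemiring.tendsto_pow_div_factorial_atTop (‖a‖ * T)).eventually_lt_const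
    (u := 1 / 2) (by norm_num)).exists
  refine ⟨n, fun f => ?_⟩
  rw [ContinuousMap.norm_le _ (by positivity)]
  intro t
  refine (norm_integralOperator_iterate_le hT a n f t).trans ?_
  refine mul_le_mul_of_nonneg_right (le_trans ?_ hn.le) (norm_nonneg _)
  have := t.2.1
  have := t.2.2
  gcongr

/-- The solution of `u' = a u + g`, `u(0) = x`. -/
def solveODE (x : E) (g : C(TimeInterval T, E)) (a : C(TimeInterval T, E →L[ℝ] E)) :
    C(TimeInterval T, E) :=
  oneSubInverse (integralOperator hT) (ContinuousMap.const _ x + volterra hT g) a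

theorem eq_solveODE_iff (a : C(TimeInterval T, E →L[ℝ] E)) (x : E) (g u : C(TimeInterval T, E)) :
    u = solveODE hT x g a ↔ u (startTime hT) = x ∧
      ∀ t : TimeInterval T,
        HasDerivWithinAt (extend hT u) (a t (u t) + g t) (Icc 0 T) (t : ℝ) := by
  rw [solveODE, eq_oneSubInverse_iff (exists_norm_integralOperator_iterate_le hT),
    sub_eq_iff_eq_add, integralOperator_apply, add_assoc, ← map_add, eq_const_add_volterra_iff,
    add_comm g]
  rfl

theorem contDiff_solveODE (x : E) (g : C(TimeInterval T, E)) :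
    ContDiff ℝ 1 (solveODE hT x g) :=
  contDiff_oneSubInverse (exists_norm_integralOperator_iterate_le hT) _

/-- The derivative `w` of the solution with respect to the coefficient solves
`w' = a w + b u`, `w(0) = 0`. -/
theorem fderiv_solveODE (x : E) (g : C(TimeInterval T, E))
    (a b : C(TimeInterval T, E →L[ℝ] E)) :
    fderiv ℝ (solveODE hT x g) a b = solveODE hT 0
      (liftBilin (TimeInterval T) (ContinuousLinearMap.id ℝ (E →L[ℝ] E)) b
        (solveODE hT x g a)) a := by
  refine (fderiv_oneSubInverse (exists_norm_integralOperator_iterate_le hT) _ a b).trans ?_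
  rw [solveODE, show ContinuousMap.const (TimeInterval T) (0 : E) = 0 from rfl, zero_add]
  rfl

end LinearODE

/-! ### Fundamental solutions in a Banach algebra -/

section Fundamental

variable {𝔸 : Type*} [NormedRing 𝔸] [NormedAlgebra ℝ 𝔸] [CompleteSpace 𝔸] {T : ℝ} (hT : 0 < T)

omit [CompleteSpace 𝔸] in
theorem hasDerivWithinAt_extend_mul {p q p' q' : TimeInterval T → 𝔸} {t : TimeInterval T}
    (hp : HasDerivWithinAt (extend hT p) (p' t) (Icc 0 T) (t : ℝ))
    (hq : HasDerivWithinAt (extend hT q) (q' t) (Icc 0 T) (t : ℝ)) :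
    HasDerivWithinAt (extend hT fun t => p t * q t) (p' t * q t + p t * q' t)
      (Icc 0 T) (t : ℝ) := by
  have := hp.mul hq
  rwa [extend_apply, extend_apply] at this

/-- A fundamental solution of `p' = a p` and its inverse. -/
theorem exists_fundamental_solution (a : C(TimeInterval T, 𝔸)) :
    ∃ p q : C(TimeInterval T, 𝔸), (∀ t, p t * q t = 1) ∧
      (∀ t : TimeInterval T, HasDerivWithinAt (extend hT p) (a t * p t) (Icc 0 T) (t : ℝ)) ∧
      (∀ t : TimeInterval T,
        HasDerivWithinAt (extend hT q) (-(q t * a t)) (Icc 0 T) (t : ℝ)) := by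
  -- Left and right multiplication by a turn p' = a p and q' = -q a into linear ODEs on the algebra
  -- itself.
  let l : C(TimeInterval T, 𝔸 →L[ℝ] 𝔸) := ⟨fun t => ContinuousLinearMap.mul ℝ 𝔸 (a t), by fun_prop⟩
  let r : C(TimeInterval T, 𝔸 →L[ℝ] 𝔸) :=
    ⟨fun t => (ContinuousLinearMap.mul ℝ 𝔸).flip (a t), by fun_prop⟩
  obtain ⟨hp0, hp⟩ := (eq_solveODE_iff hT l 1 0 _).mp rfl
  obtain ⟨hq0, hq⟩ := (eq_solveODE_iff hT (-r) 1 0 _).mp rfl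
  set p := solveODE hT 1 0 l
  set q := solveODE hT 1 0 (-r)
  have hp' : ∀ t : TimeInterval T,
      HasDerivWithinAt (extend hT p) (a t * p t) (Icc 0 T) (t : ℝ) := fun t => by
    simpa [l] using hp t
  have hq' : ∀ t : TimeInterval T,
      HasDerivWithinAt (extend hT q) (-(q t * a t)) (Icc 0 T) (t : ℝ) := fun t => by
    simpa [r] using hq t
  refine ⟨p, q, fun t => ?_, hp', hq'⟩
  -- Both p q and the constant 1 solve y' = a y - y a with y(0) = 1, so they agree by uniqueness.
  -- This yields a right inverse of p without any finite-dimensionality.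
  have h1 : p * q = solveODE hT 1 0 (l - r) := by
    rw [eq_solveODE_iff]
    refine ⟨by simp [hp0, hq0], fun t => ?_⟩
    have h3 : (l - r) t ((p * q) t) + (0 : C(TimeInterval T, 𝔸)) t =
        a t * p t * q t + p t * -(q t * a t) := by
      simp [l, r, mul_assoc, sub_eq_add_neg]
    rw [h3]
    exact hasDerivWithinAt_extend_mul hT (p' := fun t => a t * p t)
      (q' := fun t => -(q t * a t)) (hp' t) (hq' t)
  have h2 : (1 : C(TimeInterval T, 𝔸)) = solveODE hT 1 0 (l - r) := by
    rw [eq_solveODE_iff]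
    refine ⟨by simp, fun t => ?_⟩
    have h3 : (l - r) t ((1 : C(TimeInterval T, 𝔸)) t) + (0 : C(TimeInterval T, 𝔸)) t = 0 := by
      simp [l, r]
    rw [h3]
    exact hasDerivWithinAt_const (t : ℝ) (Icc 0 T) (1 : 𝔸)
  exact DFunLike.congr_fun (h1.trans h2.symm) t

end Fundamental

/-! ### The embedding of H¹₀ into L⁴ -/

section Sobolev

variable {Ω : Set Space} {N : ℕ}

theorem classicalGrad_eq_zero_of_notMem {φ : Space → EuclideanSpace ℂ (Fin N)} {x : Space}
    (hx : x ∉ tsupport φ) : classicalGrad φ x = 0 := by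
  have : fderiv ℝ φ x = 0 := by
    by_contra h
    exact hx (support_fderiv_subset ℝ h)
  ext p
  simp [classicalGrad, this]

/-- Expansion in the standard bases of ℝ³ and ℂᴺ gives the crude constant 3N. It links the operator
norm in the Sobolev inequality to the Euclidean norm of the gradient entries. -/
theorem norm_fderiv_le_norm_classicalGrad (φ : Space → EuclideanSpace ℂ (Fin N)) (x : Space) :
    ‖fderiv ℝ φ x‖ ≤ 3 * N * ‖classicalGrad φ x‖ := by
  refine ContinuousLinearMap.opNorm_le_bound _ (by positivity) fun v => ?_
  have hp : ∀ (i : Fin 3) (k : Fin N), ‖fderiv ℝ φ x (EuclideanSpace.single i (1 : ℝ)) k‖ ≤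
      ‖classicalGrad φ x‖ := fun i k =>
    PiLp.norm_apply_le (classicalGrad φ x) (k, i)
  have hi : ∀ i : Fin 3, ‖fderiv ℝ φ x (EuclideanSpace.single i (1 : ℝ))‖ ≤
      N * ‖classicalGrad φ x‖ := fun i => by
    set w := fderiv ℝ φ x (EuclideanSpace.single i (1 : ℝ))
    have hw : w = ∑ k, w k • EuclideanSpace.single k (1 : ℂ) := by
      ext k
      simp [Finset.sum_apply, Pi.single_apply]
    calc ‖w‖ ≤ ∑ k : Fin N, ‖w k • EuclideanSpace.single k (1 : ℂ)‖ := by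
          conv_lhs => rw [hw]
          exact norm_sum_le _ _
      _ ≤ ∑ _k : Fin N, ‖classicalGrad φ x‖ := Finset.sum_le_sum fun k _ => by
          simpa [norm_smul] using hp i k
      _ = N * ‖classicalGrad φ x‖ := by simp
  have hv : v = ∑ i, v i • EuclideanSpace.single i (1 : ℝ) := by
    ext k
    simp [Finset.sum_apply, Pi.single_apply]
  calc ‖fderiv ℝ φ x v‖ ≤ ∑ i : Fin 3, ‖fderiv ℝ φ x (v i • EuclideanSpace.single i (1 : ℝ))‖ := by
        conv_lhs => rw [hv, map_sum]
        exact norm_sum_le _ _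
    _ ≤ ∑ _i : Fin 3, ‖v‖ * (N * ‖classicalGrad φ x‖) := Finset.sum_le_sum fun i _ => by
        rw [map_smul, norm_smul]
        exact mul_le_mul (PiLp.norm_apply_le v i) (hi i) (norm_nonneg _) (norm_nonneg _)
    _ = 3 * N * ‖classicalGrad φ x‖ * ‖v‖ := by simp; ring

theorem zero_mem_testPairs : (0 : PairSpace Ω N) ∈ testPairs Ω N := by
  refine ⟨0, contDiff_const, HasCompactSupport.zero, by simp [tsupport], ?_, ?_⟩
  · exact Lp.coeFn_zero _ _ _
  · refine (Lp.coeFn_zero _ _ _).trans (Filter.Eventually.of_forall fun x => ?_)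
    exact (classicalGrad_eq_zero_of_notMem (by simp [tsupport])).symm

theorem add_mem_testPairs {p q : PairSpace Ω N} (hp : p ∈ testPairs Ω N)
    (hq : q ∈ testPairs Ω N) : p + q ∈ testPairs Ω N := by
  obtain ⟨φ, hφ, hφc, hφs, h1, h2⟩ := hp
  obtain ⟨χ, hχ, hχc, hχs, h3, h4⟩ := hq
  refine ⟨φ + χ, hφ.add hχ, hφc.add hχc, (tsupport_add φ χ).trans (union_subset hφs hχs), ?_, ?_⟩
  · filter_upwards [Lp.coeFn_add p.fst q.fst, h1, h3] with x hx h1 h3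
    rw [WithLp.add_fst, hx, Pi.add_apply, h1, h3, Pi.add_apply]
  · filter_upwards [Lp.coeFn_add p.snd q.snd, h2, h4] with x hx h2 h4
    rw [WithLp.add_snd, hx, Pi.add_apply, h2, h4]
    ext i
    simp [classicalGrad, fderiv_add (hφ.differentiable (by simp) x) (hχ.differentiable (by simp) x)]

theorem smul_mem_testPairs (c : ℂ) {p : PairSpace Ω N} (hp : p ∈ testPairs Ω N) :
    c • p ∈ testPairs Ω N := by
  obtain ⟨φ, hφ, hφc, hφs, h1, h2⟩ := hp
  refine ⟨c • φ, hφ.const_smul c, hφc.mono (Function.support_const_smul_subset c φ),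
    (closure_mono (Function.support_const_smul_subset c φ)).trans hφs, ?_, ?_⟩
  · filter_upwards [Lp.coeFn_smul c p.fst, h1] with x hx h1
    rw [WithLp.smul_fst, hx, Pi.smul_apply, h1, Pi.smul_apply]
  · filter_upwards [Lp.coeFn_smul c p.snd, h2] with x hx h2
    rw [WithLp.smul_snd, hx, Pi.smul_apply, h2]
    ext i
    simp [classicalGrad, fderiv_const_smul (hφ.differentiable (by simp) x)]

/-- Ensures that the sequences approximating an element of H¹₀ consist of genuine test functions, to
which the Sobolev inequality applies. -/
theorem span_testPairs_subset : (Submodule.span ℂ (testPairs Ω N) : Set (PairSpace Ω N)) ⊆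
    testPairs Ω N := fun _ hp =>
  Submodule.span_induction (fun _ h => h) zero_mem_testPairs
    (fun _ _ _ _ h h' => add_mem_testPairs h h') (fun c _ _ h => smul_mem_testPairs c h) hp

/-- The Sobolev inequality on test functions. -/
theorem exists_eLpNorm_four_le_of_mem_testPairs (hΩb : Bornology.IsBounded Ω) :
    ∃ C : NNReal, ∀ p ∈ testPairs Ω N,
      eLpNorm p.fst 4 (volume.restrict Ω) ≤ C * eLpNorm p.snd 2 (volume.restrict Ω) := by
  refine ⟨eLpNormLESNormFDerivOfLeConst (EuclideanSpace ℂ (Fin N)) (volume : Measure Space) Ω 2 4 *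
    (3 * N), ?_⟩
  rintro p ⟨φ, hφ, -, hφs, h1, h2⟩
  rw [eLpNorm_congr_ae h1, eLpNorm_congr_ae h2]
  have hs : Function.support (classicalGrad φ) ⊆ Ω := fun x hx => by
    by_contra h
    exact hx (classicalGrad_eq_zero_of_notMem fun h' => h (hφs h'))
  -- The exponents are admissible since 1/2 - 1/3 ≤ 1/4; boundedness of Ω allows 4 in place of the
  -- critical exponent 6.
  have hgns := eLpNorm_le_eLpNorm_fderiv_of_le (volume : Measure Space) (u := φ) (s := Ω)
    (hφ.of_le (by simp)) ((subset_tsupport φ).trans hφs) (p := 2) (q := 4) (by norm_num)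
    (by simp; norm_num) (by simp; norm_num) hΩb
  calc eLpNorm φ 4 (volume.restrict Ω) ≤ eLpNorm φ 4 volume := eLpNorm_restrict_le _ _ _ _
    _ ≤ _ := hgns
    _ ≤ eLpNormLESNormFDerivOfLeConst (EuclideanSpace ℂ (Fin N)) (volume : Measure Space) Ω 2 4 *
        ((3 * N : NNReal) * eLpNorm (classicalGrad φ) 2 volume) := by
      gcongr
      exact eLpNorm_le_nnreal_smul_eLpNorm_of_ae_le_mul (Filter.Eventually.of_forall fun x =>
        norm_fderiv_le_norm_classicalGrad φ x) 2
    _ = _ := by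
      rw [eLpNorm_restrict_eq_of_support_subset hs, ← mul_assoc]
      push_cast
      rfl

/-- Test functions converging in H¹₀ have bounded gradients, hence bounded L⁴ norms. Along an a.e.
convergent subsequence Fatou's lemma passes the bound to the limit. -/
theorem memLp_four_val (hΩb : Bornology.IsBounded Ω) (f : H10 Ω N) :
    MemLp (val f) 4 (volume.restrict Ω) := by
  obtain ⟨C, hC⟩ := exists_eLpNorm_four_le_of_mem_testPairs (N := N) hΩb
  have hf : f.toPair ∈ closure (Submodule.span ℂ (testPairs Ω N) : Set (PairSpace Ω N)) := f.2
  obtain ⟨p, hp, hlim⟩ := mem_closure_iff_seq_limit.mp hf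
  have hfst : Filter.Tendsto (fun n => (p n).fst) Filter.atTop (nhds f.toPair.fst) :=
    (WithLp.continuous_fst 2 _ _).continuousAt.tendsto.comp hlim
  obtain ⟨ns, hns, hae⟩ := (tendstoInMeasure_of_tendsto_Lp hfst).exists_seq_tendsto_ae
  obtain ⟨M, hM⟩ := (Metric.isBounded_range_of_tendsto _ hlim).exists_norm_le
  refine ⟨Lp.aestronglyMeasurable _, lt_of_le_of_lt (b := (C : ENNReal) * ENNReal.ofReal M) ?_
    (ENNReal.mul_lt_top ENNReal.coe_lt_top ENNReal.ofReal_lt_top)⟩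
  refine (Lp.eLpNorm_lim_le_liminf_eLpNorm (fun n => Lp.aestronglyMeasurable (p (ns n)).fst)
    _ hae).trans ?_
  refine Filter.liminf_le_of_le (by isBoundedDefault) fun b hb => ?_
  obtain ⟨n, hn⟩ := hb.exists
  refine hn.trans ((hC _ (span_testPairs_subset (hp (ns n)))).trans ?_)
  gcongr
  rw [← Lp.enorm_def, ← ofReal_norm]
  exact ENNReal.ofReal_le_ofReal ((WithLp.norm_snd_le (p := 2) _ _).trans (hM _ ⟨_, rfl⟩))

end Sobolev

/-! ### Boundedness of the Hartree potential -/

section Hartree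

variable {Ω : Set Space}

/-- In polar coordinates the Jacobian r² of dimension three cancels the singularity r⁻². -/
theorem integrable_indicator_inv_norm_sq (R : ℝ) :
    Integrable (fun z : Space => (Iio R).indicator (fun r : ℝ => r⁻¹ ^ 2) ‖z‖) := by
  rw [integrable_fun_norm_addHaar]
  have h : IntegrableOn ((Iio R).indicator fun _ : ℝ => (1 : ℝ)) (Ioi 0) := by
    rw [integrableOn_indicator_iff measurableSet_Iio]
    refine integrableOn_const (ne_of_lt ?_)
    rw [Iio_inter_Ioi]
    exact measure_Ioo_lt_top
  refine h.congr_fun (fun y hy => ?_) measurableSet_Ioi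
  have hy' : y ≠ 0 := (mem_Ioi.mp hy).ne'
  by_cases h : y ∈ Iio R
  · simp [h, hy']
  · simp [h]

/-- The Newton kernel is uniformly square integrable on bounded sets. -/
theorem exists_integral_inv_norm_sub_sq_le (hΩ : MeasurableSet Ω) (hΩb : Bornology.IsBounded Ω) :
    ∃ C : ℝ, ∀ x ∈ Ω, IntegrableOn (fun y : Space => ‖x - y‖⁻¹ ^ 2) Ω ∧
      ∫ y in Ω, ‖x - y‖⁻¹ ^ 2 ≤ C := by
  obtain ⟨R, hR⟩ := hΩb.exists_norm_le
  -- Points of Ω are at distance at most 2R, so the cutoff at 2R + 1 is inactive there. The integral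
  -- of g over all of space is invariant under z ↦ x - z, which makes the bound uniform in x.
  set g : Space → ℝ := fun z => (Iio (2 * R + 1)).indicator (fun r : ℝ => r⁻¹ ^ 2) ‖z‖ with hg
  have hgi : Integrable g := integrable_indicator_inv_norm_sq _
  refine ⟨∫ z, g z, fun x hx => ?_⟩
  have hgx : Integrable fun y => g (x - y) := hgi.comp_sub_left x
  have heq : EqOn (fun y => g (x - y)) (fun y => ‖x - y‖⁻¹ ^ 2) Ω := fun y hy => by
    have : ‖x - y‖ < 2 * R + 1 := by linarith [norm_sub_le x y, hR x hx, hR y hy]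
    simp [hg, this]
  refine ⟨hgx.integrableOn.congr_fun heq hΩ, ?_⟩
  rw [← setIntegral_congr_fun hΩ heq, ← integral_sub_left_eq_self g volume x]
  exact setIntegral_le_integral hgx (Filter.Eventually.of_forall fun y =>
    indicator_nonneg (fun r _ => by positivity) _)

theorem memLp_inv_norm_sub (hΩ : MeasurableSet Ω) (hΩb : Bornology.IsBounded Ω) {x : Space}
    (hx : x ∈ Ω) : MemLp (fun y : Space => ‖x - y‖⁻¹) 2 (volume.restrict Ω) := by
  obtain ⟨C, hC⟩ := exists_integral_inv_norm_sub_sq_le hΩ hΩb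
  refine (memLp_two_iff_integrable_sq (Measurable.aestronglyMeasurable ?_)).mpr (hC x hx).1
  fun_prop

theorem integrableOn_hartree (hΩ : MeasurableSet Ω) (hΩb : Bornology.IsBounded Ω)
    {r : Space → ℝ} (hr : MemLp r 2 (volume.restrict Ω)) {x : Space} (hx : x ∈ Ω) :
    IntegrableOn (fun y => ‖x - y‖⁻¹ * r y) Ω :=
  (memLp_inv_norm_sub hΩ hΩb hx).integrable_mul hr

/-- The pointwise bound ab ≤ (a² + b²)/2 separates the kernel from r, and the kernel part is uniform
in x ∈ Ω. -/
theorem memLp_top_hartree (hΩ : MeasurableSet Ω) (hΩb : Bornology.IsBounded Ω)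
    {r : Space → ℝ} (hr : MemLp r 2 (volume.restrict Ω)) :
    MemLp (hartree Ω r) ⊤ (volume.restrict Ω) := by
  obtain ⟨C, hC⟩ := exists_integral_inv_norm_sub_sq_le hΩ hΩb
  refine memLp_top_of_bound ?_ (C / 2 + (∫ y in Ω, r y ^ 2) / 2) ?_
  · refine AEStronglyMeasurable.integral_prod_right' (f := fun p : Space × Space =>
      ‖p.1 - p.2‖⁻¹ * r p.2) (AEStronglyMeasurable.mul (Measurable.aestronglyMeasurable ?_)
      hr.1.comp_snd)
    fun_prop
  · refine ae_restrict_of_forall_mem hΩ fun x hx => ?_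
    obtain ⟨h1, h2⟩ := hC x hx
    refine (norm_integral_le_of_norm_le ((h1.div_const 2).add (hr.integrable_sq.div_const 2))
      (Filter.Eventually.of_forall fun y => ?_)).trans ?_
    · rw [norm_mul, norm_inv, norm_norm, Real.norm_eq_abs]
      simp only [Pi.add_apply]
      nlinarith [sq_nonneg (‖x - y‖⁻¹ - |r y|), sq_abs (r y)]
    · simp only [Pi.add_apply]
      rw [integral_add (h1.div_const 2) (hr.integrable_sq.div_const 2), integral_div, integral_div]
      linarith

theorem hartree_congr_ae {r r' : Space → ℝ} (h : r =ᵐ[volume.restrict Ω] r') (x : Space) :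
    hartree Ω r x = hartree Ω r' x :=
  integral_congr_ae (h.mono fun y hy => by simp only [hy])

theorem hartree_add (hΩ : MeasurableSet Ω) (hΩb : Bornology.IsBounded Ω) {r r' : Space → ℝ}
    (hr : MemLp r 2 (volume.restrict Ω)) (hr' : MemLp r' 2 (volume.restrict Ω)) {x : Space}
    (hx : x ∈ Ω) : hartree Ω (r + r') x = hartree Ω r x + hartree Ω r' x := by
  unfold hartree
  rw [← integral_add (integrableOn_hartree hΩ hΩb hr hx) (integrableOn_hartree hΩ hΩb hr' hx)]
  simp [mul_add]

theorem hartree_smul (c : ℝ) (r : Space → ℝ) (x : Space) :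
    hartree Ω (c • r) x = c * hartree Ω r x := by
  unfold hartree
  rw [← integral_const_mul]
  congr 1
  ext y
  simp only [Pi.smul_apply, smul_eq_mul]
  ring

end Hartree

/-! ### Bilinear forms with bounded multipliers -/

section MultiplierForm

variable {Ω : Set Space} {ι : Type*} [Fintype ι]

/-- `L²(Ω; ℂ^ι)`. -/
abbrev L2 (Ω : Set Space) (ι : Type*) [Fintype ι] : Type _ :=
  Lp (EuclideanSpace ℂ ι) 2 (volume.restrict Ω)

theorem memLp_apply {p : ENNReal} {f : Space → EuclideanSpace ℂ ι}
    (hf : MemLp f p (volume.restrict Ω)) (k : ι) :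
    MemLp (fun x => f x k) p (volume.restrict Ω) :=
  (EuclideanSpace.proj (𝕜 := ℂ) k).comp_memLp' hf

theorem integrable_sum_mul (f g : L2 Ω ι) :
    Integrable (fun x => ∑ k, f x k * g x k) (volume.restrict Ω) :=
  integrable_finsetSum _ fun k _ =>
    (memLp_apply (Lp.memLp f) k).integrable_mul (memLp_apply (Lp.memLp g) k)

theorem integrable_multiplier_mul_sum {q : Space → ℝ} (hq : MemLp q ⊤ (volume.restrict Ω))
    (f g : L2 Ω ι) :
    Integrable (fun x => (q x : ℂ) * ∑ k, f x k * g x k) (volume.restrict Ω) :=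
  (MemLp.ofReal (K := ℂ) hq).integrable_mul (memLp_one_iff_integrable.mpr (integrable_sum_mul f g))

/-- The bilinear form `∫_Ω q f g` on `L²` for a bounded multiplier `q`. -/
def multiplierBilin {q : Space → ℝ} (hq : MemLp q ⊤ (volume.restrict Ω)) :
    L2 Ω ι →ₗ[ℂ] L2 Ω ι →ₗ[ℂ] ℂ :=
  LinearMap.mk₂ ℂ (fun f g => ∫ x in Ω, (q x : ℂ) * ∑ k, f x k * g x k)
    (fun f f' g => by
      rw [← integral_add (integrable_multiplier_mul_sum hq f g)
        (integrable_multiplier_mul_sum hq f' g)]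
      refine integral_congr_ae ((Lp.coeFn_add f f').mono fun x hx => ?_)
      simp only [hx, Pi.add_apply, PiLp.add_apply, add_mul, Finset.sum_add_distrib, mul_add])
    (fun c f g => by
      rw [← integral_smul]
      refine integral_congr_ae ((Lp.coeFn_smul c f).mono fun x hx => ?_)
      simp only [hx, Pi.smul_apply, PiLp.smul_apply, smul_eq_mul, Finset.mul_sum]
      exact Finset.sum_congr rfl fun k _ => by ring)
    (fun f g g' => by
      rw [← integral_add (integrable_multiplier_mul_sum hq f g)
        (integrable_multiplier_mul_sum hq f g')]
      refine integral_congr_ae ((Lp.coeFn_add g g').mono fun x hx => ?_)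
      simp only [hx, Pi.add_apply, PiLp.add_apply, mul_add, Finset.sum_add_distrib])
    (fun c f g => by
      rw [← integral_smul]
      refine integral_congr_ae ((Lp.coeFn_smul c g).mono fun x hx => ?_)
      simp only [hx, Pi.smul_apply, PiLp.smul_apply, smul_eq_mul, Finset.mul_sum]
      exact Finset.sum_congr rfl fun k _ => by ring)

theorem multiplierBilin_apply {q : Space → ℝ} (hq : MemLp q ⊤ (volume.restrict Ω)) (f g : L2 Ω ι) :
    multiplierBilin hq f g = ∫ x in Ω, (q x : ℂ) * ∑ k, f x k * g x k := rfl

theorem multiplierBilin_congr {q q' : Space → ℝ} (hΩ : MeasurableSet Ω)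
    (hq : MemLp q ⊤ (volume.restrict Ω)) (hq' : MemLp q' ⊤ (volume.restrict Ω))
    (h : EqOn q q' Ω) : multiplierBilin (ι := ι) hq = multiplierBilin hq' := by
  ext f g
  exact setIntegral_congr_fun hΩ fun x hx => by simp only [h hx]

theorem multiplierBilin_add {q q' : Space → ℝ} (hq : MemLp q ⊤ (volume.restrict Ω))
    (hq' : MemLp q' ⊤ (volume.restrict Ω)) :
    multiplierBilin (ι := ι) (hq.add hq') = multiplierBilin hq + multiplierBilin hq' := by
  ext f g
  simp only [multiplierBilin_apply, LinearMap.add_apply]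
  rw [← integral_add (integrable_multiplier_mul_sum hq f g)
    (integrable_multiplier_mul_sum hq' f g)]
  simp [add_mul]

theorem multiplierBilin_smul {q : Space → ℝ} (c : ℝ) (hq : MemLp q ⊤ (volume.restrict Ω)) :
    multiplierBilin (ι := ι) (hq.const_smul c) = c • multiplierBilin hq := by
  ext f g
  simp only [multiplierBilin_apply, LinearMap.smul_apply]
  rw [← integral_smul]
  simp [mul_assoc]

end MultiplierForm

/-! ### The density as a real-bilinear expression -/

section ReProduct

variable {Ω : Set Space} {N : ℕ}

/-- The values of an element of `H¹₀`, as an element of `L²`. -/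
def valLinear (Ω : Set Space) (N : ℕ) : H10 Ω N →ₗ[ℂ] L2 Ω (Fin N) where
  toFun f := f.toPair.fst
  map_add' _ _ := rfl
  map_smul' _ _ := rfl

/-- The weak gradient of an element of `H¹₀`, as an element of `L²`. -/
def gradLinear (Ω : Set Space) (N : ℕ) : H10 Ω N →ₗ[ℂ] L2 Ω (Fin N × Fin 3) where
  toFun f := f.toPair.snd
  map_add' _ _ := rfl
  map_smul' _ _ := rfl

theorem val_add_ae (f g : H10 Ω N) : val (f + g) =ᵐ[volume.restrict Ω] val f + val g :=
  Lp.coeFn_add f.toPair.fst g.toPair.fst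

theorem val_smul_ae (c : ℂ) (f : H10 Ω N) : val (c • f) =ᵐ[volume.restrict Ω] c • val f :=
  Lp.coeFn_smul c f.toPair.fst

theorem reProduct_comm (f g : H10 Ω N) : reProduct f g = reProduct g f := by
  ext y
  refine Finset.sum_congr rfl fun k _ => ?_
  simp only [Complex.mul_re, Complex.conj_re, Complex.conj_im]
  ring

/-- The density is the diagonal of a symmetric real-bilinear map, which makes the potential
quadratic in ψ. -/
theorem density_eq_reProduct (f : H10 Ω N) : density f = reProduct f f := by
  ext y
  refine Finset.sum_congr rfl fun k _ => ?_
  rw [← Complex.normSq_eq_norm_sq, ← Complex.normSq_eq_conj_mul_self, Complex.ofReal_re]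

theorem reProduct_add_ae (f f' g : H10 Ω N) :
    reProduct (f + f') g =ᵐ[volume.restrict Ω] reProduct f g + reProduct f' g := by
  filter_upwards [val_add_ae f f'] with y hy
  simp [reProduct, hy, Finset.sum_add_distrib, add_mul]

theorem reProduct_smul_ae (c : ℝ) (f g : H10 Ω N) :
    reProduct ((c : ℂ) • f) g =ᵐ[volume.restrict Ω] c • reProduct f g := by
  filter_upwards [val_smul_ae (c : ℂ) f] with y hy
  simp only [reProduct, hy, Pi.smul_apply, PiLp.smul_apply, smul_eq_mul, map_mul,
    Complex.conj_ofReal, Finset.mul_sum, mul_assoc, Complex.re_ofReal_mul]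

/-- Hölder's inequality with 1/4 + 1/4 = 1/2, applied to each component. -/
theorem memLp_two_reProduct (hΩb : Bornology.IsBounded Ω) (f g : H10 Ω N) :
    MemLp (reProduct f g) 2 (volume.restrict Ω) := by
  have : ENNReal.HolderTriple 4 4 2 := ⟨by
    rw [← ENNReal.toReal_eq_toReal_iff' (by simp) (by simp), ENNReal.toReal_add (by simp) (by simp)]
    norm_num⟩
  refine memLp_finsetSum _ fun k _ => ?_
  have h : MemLp (fun y => conj (val f y k) * val g y k) 2 (volume.restrict Ω) :=
    MemLp.mul (memLp_apply (memLp_four_val hΩb g) k) (memLp_apply (memLp_four_val hΩb f) k).star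
  exact h.re

end ReProduct

/-! ### Evolution operators and variation of constants -/

section ComplexLinearODE

variable {E : Type*} [NormedAddCommGroup E] [NormedSpace ℂ E]

/-- Restriction of scalars on bounded operators. -/
def realify (E : Type*) [NormedAddCommGroup E] [NormedSpace ℂ E] :
    (E →L[ℂ] E) →L[ℝ] (E →L[ℝ] E) :=
  ContinuousLinearMap.restrictScalarsL ℂ E E ℝ ℝ

@[simp]
theorem realify_apply (L : E →L[ℂ] E) (x : E) : realify E L x = L x := rfl

/-- `realify` applied to the values of a bilinear map. -/
def realifyBilin {X Y : Type*} [NormedAddCommGroup X] [NormedSpace ℝ X] [NormedAddCommGroup Y]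
    [NormedSpace ℝ Y] (B : BoundedBilin X Y (E →L[ℂ] E)) : BoundedBilin X Y (E →L[ℝ] E) :=
  (ContinuousLinearMap.compL ℝ Y (E →L[ℂ] E) (E →L[ℝ] E) (realify E)) ∘L B

variable {T : ℝ} (hT : 0 < T)

theorem hasDerivWithinAt_extend_apply {p : TimeInterval T → E →L[ℂ] E} {u : TimeInterval T → E}
    {t : TimeInterval T} {p' : E →L[ℂ] E} {u' : E}
    (hp : HasDerivWithinAt (extend hT p) p' (Icc 0 T) (t : ℝ))
    (hu : HasDerivWithinAt (extend hT u) u' (Icc 0 T) (t : ℝ)) :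
    HasDerivWithinAt (extend hT fun t => p t (u t)) (p' (u t) + p t u') (Icc 0 T) (t : ℝ) := by
  have := ((realify E).hasFDerivAt.comp_hasDerivWithinAt (t : ℝ) hp).clm_apply hu
  simp only [Function.comp_apply, extend_apply, realify_apply] at this
  exact this

/-- `p` is a fundamental solution of `u' = a u`, and `q` is its inverse. -/
structure IsFundamentalPair (a p q : C(TimeInterval T, E →L[ℂ] E)) : Prop where
  mul_inv : ∀ t, p t * q t = 1
  deriv : ∀ t : TimeInterval T,
    HasDerivWithinAt (extend hT p) (a t * p t) (Icc 0 T) (t : ℝ)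
  deriv_inv : ∀ t : TimeInterval T,
    HasDerivWithinAt (extend hT q) (-(q t * a t)) (Icc 0 T) (t : ℝ)

variable {hT} {a p q : C(TimeInterval T, E →L[ℂ] E)}

theorem exists_isFundamentalPair [CompleteSpace E] (hT : 0 < T)
    (a : C(TimeInterval T, E →L[ℂ] E)) :
    ∃ p q, IsFundamentalPair hT a p q := by
  obtain ⟨p, q, h1, h2, h3⟩ := exists_fundamental_solution hT a
  exact ⟨p, q, h1, h2, h3⟩

namespace IsFundamentalPair

variable (h : IsFundamentalPair hT a p q)
include h

theorem apply_inv_apply (t : TimeInterval T) (x : E) : p t (q t x) = x :=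
  DFunLike.congr_fun (h.mul_inv t) x

theorem hasDerivWithinAt_apply (x : E) (t : TimeInterval T) :
    HasDerivWithinAt (extend hT fun t => p t x) (a t (p t x)) (Icc 0 T) (t : ℝ) := by
  have := hasDerivWithinAt_extend_apply hT (u := fun _ => x) (h.deriv t)
    (hasDerivWithinAt_const (t : ℝ) (Icc 0 T) x)
  simpa using this

/-- The function q u has derivative -q a u + q a u = 0, so it is constant. Hence p(t) q(s) carries
the value at any time s, earlier or later, to the value at t. -/
theorem eq_of_hasDerivWithinAt {u : TimeInterval T → E}
    (hu : ∀ t : TimeInterval T,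
      HasDerivWithinAt (extend hT u) (a t (u t)) (Icc 0 T) (t : ℝ)) (s t : TimeInterval T) :
    u t = p t (q s (u s)) := by
  have hc := eq_startTime_of_hasDerivWithinAt_zero hT (u := fun t => q t (u t)) (fun t => by
    have := hasDerivWithinAt_extend_apply hT (h.deriv_inv t) (hu t)
    simpa using this)
  rw [← h.apply_inv_apply t (u t)]
  congr 1
  exact (hc t).trans (hc s).symm

/-- Variation of constants. -/
theorem solveODE_zero_eq [CompleteSpace E] (g : C(TimeInterval T, E)) (t : TimeInterval T) :
    solveODE hT 0 g ((realify E : C(E →L[ℂ] E, E →L[ℝ] E)).comp a) t =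
      ∫ s in (0 : ℝ)..t, p t (q (projIcc 0 T hT.le s) (g (projIcc 0 T hT.le s))) := by
  let f : C(TimeInterval T, E) := ⟨fun t => q t (g t), by fun_prop⟩
  let w : C(TimeInterval T, E) := ⟨fun t => p t (volterra hT f t), by fun_prop⟩
  have hw : w = solveODE hT 0 g ((realify E : C(E →L[ℂ] E, E →L[ℝ] E)).comp a) := by
    rw [eq_solveODE_iff]
    refine ⟨?_, fun t => ?_⟩
    · change p _ (volterra hT f _) = 0
      rw [volterra_startTime, map_zero]
    · have := hasDerivWithinAt_extend_apply hT (h.deriv t) (hasDerivWithinAt_volterra hT f t)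
      have hf : p t (f t) = g t := h.apply_inv_apply t (g t)
      rw [hf] at this
      exact this
  rw [← hw]
  exact ((p t).intervalIntegral_comp_comm
    ((continuous_extend hT f.continuous).intervalIntegrable _ _)).symm

end IsFundamentalPair

/-! ### The solution as a function of ψ -/

section SolutionMap

variable (hT : 0 < T) (a₀ : C(TimeInterval T, E →L[ℂ] E))
  (H : BoundedBilin E E (E →L[ℂ] E)) (x₀ : E)

/-- The coefficient `a₀ + H(ψ, ψ)`. -/
def quadraticCoeff (ψ : C(TimeInterval T, E)) : C(TimeInterval T, E →L[ℂ] E) :=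
  a₀ + liftBilin (TimeInterval T) H ψ ψ

/-- `quadraticCoeff` with values in the real-linear operators. -/
def realQuadraticCoeff (ψ : C(TimeInterval T, E)) : C(TimeInterval T, E →L[ℝ] E) :=
  (realify E : C(E →L[ℂ] E, E →L[ℝ] E)).comp (quadraticCoeff a₀ H ψ)

theorem realQuadraticCoeff_eq :
    realQuadraticCoeff a₀ H = fun ψ : C(TimeInterval T, E) =>
      (realify E : C(E →L[ℂ] E, E →L[ℝ] E)).comp a₀ +
        liftBilin (TimeInterval T) (realifyBilin H) ψ ψ := rfl

theorem contDiff_realQuadraticCoeff :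
    ContDiff ℝ 1 (realQuadraticCoeff a₀ H : C(TimeInterval T, E) → _) := by
  rw [realQuadraticCoeff_eq]
  exact contDiff_const.add
    ((liftBilin (TimeInterval T) (realifyBilin H)).contDiff.clm_apply contDiff_id)

variable {H} (hH : ∀ x y, H x y = H y x)

include hH in
-- The two terms of the product rule coincide by symmetry of H; this is the factor 2 of the
-- derivative formula.
theorem fderiv_realQuadraticCoeff (ψ ω : C(TimeInterval T, E)) :
    fderiv ℝ (realQuadraticCoeff a₀ H) ψ ω =
      (2 : ℝ) • liftBilin (TimeInterval T) (realifyBilin H) ψ ω := by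
  have h := (((liftBilin (TimeInterval T) (realifyBilin H)).hasFDerivAt (x := ψ)).clm_apply
    (hasFDerivAt_id ψ)).const_add ((realify E : C(E →L[ℂ] E, E →L[ℝ] E)).comp a₀)
  rw [realQuadraticCoeff_eq]
  refine (congrArg (fun L => L ω) h.fderiv).trans ?_
  ext t x
  change H (ψ t) (ω t) x + H (ω t) (ψ t) x = (2 : ℝ) • H (ψ t) (ω t) x
  rw [hH (ω t), two_smul]

variable [CompleteSpace E]

variable (H) in
/-- The map from `ψ` to the solution of `u' = (a₀ + H(ψ, ψ)) u`, `u(0) = x₀`. -/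
def solutionMap (ψ : C(TimeInterval T, E)) : C(TimeInterval T, E) :=
  solveODE hT x₀ 0 (realQuadraticCoeff a₀ H ψ)

variable (H) in
theorem eq_solutionMap_iff (ψ u : C(TimeInterval T, E)) :
    u = solutionMap hT a₀ H x₀ ψ ↔ u (startTime hT) = x₀ ∧ ∀ t : TimeInterval T,
      HasDerivWithinAt (extend hT u) (quadraticCoeff a₀ H ψ t (u t)) (Icc 0 T) (t : ℝ) := by
  rw [solutionMap, eq_solveODE_iff]
  refine and_congr_right fun _ => forall_congr' fun t => ?_
  rw [ContinuousMap.zero_apply, add_zero]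
  rfl

variable (H) in
theorem contDiff_solutionMap : ContDiff ℝ 1 (solutionMap hT a₀ H x₀) :=
  (contDiff_solveODE hT x₀ 0).comp (contDiff_realQuadraticCoeff a₀ H)

include hH in
-- By the chain rule the derivative solves the linearised equation with source 2 H(ψ, ω) u and zero
-- initial value, to which variation of constants applies.
theorem fderiv_solutionMap_apply {ψ : C(TimeInterval T, E)} {p q : C(TimeInterval T, E →L[ℂ] E)}
    (h : IsFundamentalPair hT (quadraticCoeff a₀ H ψ) p q) (ω : C(TimeInterval T, E))
    (t : TimeInterval T) :
    fderiv ℝ (solutionMap hT a₀ H x₀) ψ ω t =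
      (2 : ℂ) • ∫ s in (0 : ℝ)..t, p t (q (projIcc 0 T hT.le s)
        (H (ψ (projIcc 0 T hT.le s)) (ω (projIcc 0 T hT.le s))
          (solutionMap hT a₀ H x₀ ψ (projIcc 0 T hT.le s)))) := by
  have h1 : fderiv ℝ (solutionMap hT a₀ H x₀) ψ ω = solveODE hT 0
      (liftBilin (TimeInterval T) (ContinuousLinearMap.id ℝ (E →L[ℝ] E))
        (fderiv ℝ (realQuadraticCoeff a₀ H) ψ ω) (solutionMap hT a₀ H x₀ ψ))
      (realQuadraticCoeff a₀ H ψ) :=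
    (congrArg (fun L => L ω) (fderiv_comp ψ
      ((contDiff_solveODE hT x₀ 0).differentiable one_ne_zero _)
      ((contDiff_realQuadraticCoeff a₀ H).differentiable one_ne_zero ψ))).trans
      (fderiv_solveODE hT x₀ 0 _ _)
  rw [h1, fderiv_realQuadraticCoeff a₀ hH, realQuadraticCoeff, h.solveODE_zero_eq,
    ← intervalIntegral.integral_smul]
  refine intervalIntegral.integral_congr fun s _ => ?_
  change p t (q _ ((2 : ℝ) • H (ψ _) (ω _) (solutionMap hT a₀ H x₀ ψ (projIcc 0 T hT.le s)))) = _
  rw [← Complex.coe_smul, map_smul, map_smul, Complex.ofReal_ofNat]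

end SolutionMap

end ComplexLinearODE

/-! ### The external potential -/

section Potential

variable {Ω : Set Space} {T : ℝ} {V : Space × ℝ → ℝ}

theorem continuousOn_potential (hT : 0 < T) (hV : IsC1OnClosure (Ω ×ˢ Ioo 0 T) V) :
    ContinuousOn V (closure Ω ×ˢ Icc 0 T) := by
  have h := hV.1
  rwa [closure_prod_eq, closure_Ioo hT.ne] at h

theorem exists_norm_potential_le (hT : 0 < T) (hΩb : Bornology.IsBounded Ω)
    (hV : IsC1OnClosure (Ω ×ˢ Ioo 0 T) V) :
    ∃ C, ∀ p ∈ closure Ω ×ˢ Icc 0 T, ‖V p‖ ≤ C :=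
  (hΩb.isCompact_closure.prod isCompact_Icc).exists_bound_of_continuousOn
    (continuousOn_potential hT hV)

theorem memLp_top_potential (hT : 0 < T) (hΩ : MeasurableSet Ω) (hΩb : Bornology.IsBounded Ω)
    (hV : IsC1OnClosure (Ω ×ˢ Ioo 0 T) V) (t : TimeInterval T) :
    MemLp (fun x => V (x, (t : ℝ))) ⊤ (volume.restrict Ω) := by
  obtain ⟨C, hC⟩ := exists_norm_potential_le hT hΩb hV
  refine memLp_top_of_bound (ContinuousOn.aestronglyMeasurable ?_ hΩ) C
    (ae_restrict_of_forall_mem hΩ fun x hx => hC _ ⟨subset_closure hx, t.2⟩)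
  exact (continuousOn_potential hT hV).comp (by fun_prop) fun x hx => ⟨subset_closure hx, t.2⟩

/-- Dominated convergence: V is continuous, hence bounded, on the compact closure of the space-time
cylinder. -/
theorem continuous_multiplierBilin_potential {ι : Type*} [Fintype ι] (hT : 0 < T)
    (hΩ : MeasurableSet Ω) (hΩb : Bornology.IsBounded Ω)
    (hV : IsC1OnClosure (Ω ×ˢ Ioo 0 T) V) (f g : L2 Ω ι) :
    Continuous fun t : TimeInterval T =>
      multiplierBilin (memLp_top_potential hT hΩ hΩb hV t) f g := by
  obtain ⟨C, hC⟩ := exists_norm_potential_le hT hΩb hV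
  refine continuous_of_dominated (bound := fun x => C * ‖∑ k, f x k * g x k‖)
    (fun t => (integrable_multiplier_mul_sum (memLp_top_potential hT hΩ hΩb hV t) f g).1)
    (fun t => ae_restrict_of_forall_mem hΩ fun x hx => ?_)
    ((integrable_sum_mul f g).norm.const_mul C)
    (ae_restrict_of_forall_mem hΩ fun x hx => ?_)
  · rw [norm_mul, Complex.norm_real]
    exact mul_le_mul_of_nonneg_right (hC _ ⟨subset_closure hx, t.2⟩) (norm_nonneg _)
  · refine (Complex.continuous_ofReal.comp ?_).mul continuous_const
    exact (continuousOn_potential hT hV).comp_continuous (by fun_prop)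
      fun t => ⟨subset_closure hx, t.2⟩

end Potential

/-- In a basis the form is a matrix whose entries are continuous, and a linear map on matrices is
continuous. This upgrades entrywise continuity to operator norm continuity of the coefficient. -/
theorem continuous_linearMap_comp_bilin {X Y τ : Type*} [AddCommGroup X] [Module ℂ X]
    [FiniteDimensional ℂ X] [NormedAddCommGroup Y] [NormedSpace ℂ Y] [TopologicalSpace τ]
    (L : (X →ₗ[ℂ] X →ₗ[ℂ] ℂ) →ₗ[ℂ] Y) {B : τ → X →ₗ[ℂ] X →ₗ[ℂ] ℂ}
    (hB : ∀ u v, Continuous fun t => B t u v) : Continuous fun t => L (B t) := by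
  classical
  let b := Module.finBasis ℂ X
  let e := LinearMap.toMatrix₂ (R := ℂ) (N₂ := ℂ) (σ₁ := RingHom.id ℂ) (σ₂ := RingHom.id ℂ) b b
  have h1 : Continuous (L ∘ₗ e.symm.toLinearMap) := LinearMap.continuous_of_finiteDimensional _
  have h2 : Continuous fun t => e (B t) := by
    refine continuous_matrix fun i j => ?_
    simpa [e, LinearMap.toMatrix₂_apply] using hB (b i) (b j)
  refine (h1.comp h2).congr fun t => ?_
  simp

/-- A bilinear map on a finite-dimensional space as a bounded bilinear map. -/
def continuousBilin {X G : Type*} [NormedAddCommGroup X] [NormedSpace ℝ X]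
    [FiniteDimensional ℝ X] [NormedAddCommGroup G] [NormedSpace ℝ G]
    (B : X →ₗ[ℝ] X →ₗ[ℝ] G) : BoundedBilin X X G :=
  LinearMap.toContinuousBilinearMap B

/-! ### From forms on F to operators on F -/

section Forms

variable {Ω : Set Space} {N : ℕ} {F : Submodule ℂ (H10 Ω N)}

/-- The form `∫_Ω q u v` on `F` for a bounded multiplier `q`. -/
def valForm (F : Submodule ℂ (H10 Ω N)) {q : Space → ℝ} (hq : MemLp q ⊤ (volume.restrict Ω)) :
    F →ₗ[ℂ] F →ₗ[ℂ] ℂ :=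
  (multiplierBilin hq).compl₁₂ (valLinear Ω N ∘ₗ F.subtype) (valLinear Ω N ∘ₗ F.subtype)

theorem valForm_apply {q : Space → ℝ} (hq : MemLp q ⊤ (volume.restrict Ω)) (u v : F) :
    valForm F hq u v = multiplierForm q (u : H10 Ω N) (v : H10 Ω N) := rfl

/-- The form `c ∫_Ω ∇u ∇v` on `F`. -/
def kineticForm (F : Submodule ℂ (H10 Ω N)) (c : ℝ) : F →ₗ[ℂ] F →ₗ[ℂ] ℂ :=
  (multiplierBilin (memLp_top_const c)).compl₁₂ (gradLinear Ω N ∘ₗ F.subtype)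
    (gradLinear Ω N ∘ₗ F.subtype)

theorem pairing_eq_valForm (u v : F) :
    pairing (u : H10 Ω N) (v : H10 Ω N) = valForm F (memLp_top_const (1 : ℝ)) u v := by
  rw [valForm_apply]
  simp [pairing, multiplierForm]

/-- The real-bilinear family of forms `(f, g) ↦ ∫_Ω (Re(f̄ g) ∗ W) u v`. -/
def hartreeForm (F : Submodule ℂ (H10 Ω N)) (hΩ : MeasurableSet Ω)
    (hΩb : Bornology.IsBounded Ω) : F →ₗ[ℝ] F →ₗ[ℝ] F →ₗ[ℂ] F →ₗ[ℂ] ℂ :=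
  have hm := fun f g : F => memLp_two_reProduct hΩb (f : H10 Ω N) (g : H10 Ω N)
  have hadd : ∀ f f' g : F, valForm F (memLp_top_hartree hΩ hΩb (hm (f + f') g)) =
      valForm F (memLp_top_hartree hΩ hΩb (hm f g)) +
        valForm F (memLp_top_hartree hΩ hΩb (hm f' g)) := fun f f' g => by
    have h := multiplierBilin_congr (ι := Fin N) hΩ (memLp_top_hartree hΩ hΩb (hm (f + f') g))
      ((memLp_top_hartree hΩ hΩb (hm f g)).add (memLp_top_hartree hΩ hΩb (hm f' g)))
      (fun x hx => (hartree_congr_ae (reProduct_add_ae (f : H10 Ω N) f' g) x).trans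
        (hartree_add hΩ hΩb (hm f g) (hm f' g) hx))
    rw [multiplierBilin_add (memLp_top_hartree hΩ hΩb (hm f g))
      (memLp_top_hartree hΩ hΩb (hm f' g))] at h
    simp only [valForm, h]
    rfl
  have hsmul : ∀ (c : ℝ) (f g : F), valForm F (memLp_top_hartree hΩ hΩb (hm (c • f) g)) =
      c • valForm F (memLp_top_hartree hΩ hΩb (hm f g)) := fun c f g => by
    have h := multiplierBilin_congr (ι := Fin N) hΩ (memLp_top_hartree hΩ hΩb (hm (c • f) g))
      ((memLp_top_hartree hΩ hΩb (hm f g)).const_smul c)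
      (fun x hx => (hartree_congr_ae (reProduct_smul_ae c (f : H10 Ω N) g) x).trans
        (hartree_smul c _ x))
    rw [multiplierBilin_smul c (memLp_top_hartree hΩ hΩb (hm f g))] at h
    simp only [valForm, h]
    rfl
  have hcomm : ∀ f g : F, valForm F (memLp_top_hartree hΩ hΩb (hm f g)) =
      valForm F (memLp_top_hartree hΩ hΩb (hm g f)) := fun f g => by
    congr 2
    exact reProduct_comm _ _
  LinearMap.mk₂ ℝ (fun f g => valForm F (memLp_top_hartree hΩ hΩb (hm f g)))
    hadd hsmul
    (fun f g g' => by rw [hcomm, hadd, hcomm g, hcomm g'])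
    (fun c f g => by rw [hcomm, hsmul, hcomm g])

theorem hartreeForm_apply (hΩ : MeasurableSet Ω) (hΩb : Bornology.IsBounded Ω) (f g u v : F) :
    hartreeForm F hΩ hΩb f g u v =
      multiplierForm (hartree Ω (reProduct (f : H10 Ω N) (g : H10 Ω N))) (u : H10 Ω N)
        (v : H10 Ω N) := rfl

theorem hartreeForm_comm (hΩ : MeasurableSet Ω) (hΩb : Bornology.IsBounded Ω) (f g : F) :
    hartreeForm F hΩ hΩb f g = hartreeForm F hΩ hΩb g f := by
  ext u v
  rw [hartreeForm_apply, hartreeForm_apply, reProduct_comm]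

theorem galerkinForm_eq {T : ℝ} (hT : 0 < T) (hΩ : MeasurableSet Ω)
    (hΩb : Bornology.IsBounded Ω) (hbar m : ℝ) {V : Space × ℝ → ℝ}
    (hV : IsC1OnClosure (Ω ×ˢ Ioo 0 T) V) (ψ : PathSpace T F) (t : TimeInterval T) (u v : F) :
    galerkinForm hbar m V ψ t u v =
      (kineticForm F (hbar ^ 2 / (2 * m)) + valForm F (memLp_top_potential hT hΩ hΩb hV t) +
        hartreeForm F hΩ hΩb (ψ t) (ψ t)) u v := by
  have hρ := memLp_top_hartree hΩ hΩb
    (memLp_two_reProduct hΩb (ψ t : H10 Ω N) (ψ t : H10 Ω N))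
  have hk := integrable_multiplier_mul_sum (Ω := Ω) (memLp_top_const (hbar ^ 2 / (2 * m)))
    (gradLinear Ω N u) (gradLinear Ω N v)
  have hp := integrable_multiplier_mul_sum (memLp_top_potential hT hΩ hΩb hV t)
    (valLinear Ω N u) (valLinear Ω N v)
  have hh := integrable_multiplier_mul_sum hρ (valLinear Ω N u) (valLinear Ω N v)
  have e : (kineticForm F (hbar ^ 2 / (2 * m)) +
      valForm F (memLp_top_potential hT hΩ hΩb hV t) + hartreeForm F hΩ hΩb (ψ t) (ψ t)) u v =
      (∫ x in Ω, ((hbar ^ 2 / (2 * m) : ℝ) : ℂ) *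
        ∑ p, gradLinear Ω N u x p * gradLinear Ω N v x p) +
      (∫ x in Ω, (V (x, (t : ℝ)) : ℂ) * ∑ k, valLinear Ω N u x k * valLinear Ω N v x k) +
      ∫ x in Ω, (hartree Ω (reProduct (ψ t : H10 Ω N) (ψ t : H10 Ω N)) x : ℂ) *
        ∑ k, valLinear Ω N u x k * valLinear Ω N v x k := rfl
  rw [e, ← integral_add hk hp]
  refine Eq.trans ?_ (integral_add (hk.add hp) hh)
  unfold galerkinForm
  congr 1
  ext x
  rw [density_eq_reProduct, Complex.ofReal_add, add_mul, ← add_assoc]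
  rfl

variable [FiniteDimensional ℂ F]

/-- The isomorphism of `F` with its dual given by a nondegenerate pairing. -/
def pairingEquiv (hF : ∀ u : F, (∀ v : F, pairing (u : H10 Ω N) (v : H10 Ω N) = 0) → u = 0) :
    F ≃ₗ[ℂ] F →ₗ[ℂ] ℂ :=
  -- Nondegeneracy is injectivity; equality of dim F and the dimension of its dual gives
  -- surjectivity.
  LinearMap.linearEquivOfInjective (valForm F (memLp_top_const (1 : ℝ)))
    ((injective_iff_map_eq_zero _).mpr fun u hu => hF u fun v => by
      rw [pairing_eq_valForm, hu, LinearMap.zero_apply])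
    Subspace.dual_finrank_eq.symm

variable (hF : ∀ u : F, (∀ v : F, pairing (u : H10 Ω N) (v : H10 Ω N) = 0) → u = 0)

theorem pairing_pairingEquiv_symm (l : F →ₗ[ℂ] ℂ) (v : F) :
    pairing (((pairingEquiv hF).symm l : F) : H10 Ω N) (v : H10 Ω N) = l v := by
  rw [pairing_eq_valForm]
  exact DFunLike.congr_fun ((pairingEquiv hF).apply_symm_apply l) v

include hF in
theorem eq_of_pairing_eq {g g' : F}
    (h : ∀ v : F, pairing (g : H10 Ω N) (v : H10 Ω N) = pairing (g' : H10 Ω N) (v : H10 Ω N)) :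
    g = g' := by
  refine (pairingEquiv hF).injective (LinearMap.ext fun v => ?_)
  have := h v
  rwa [pairing_eq_valForm, pairing_eq_valForm] at this

/-- The choice in `representative` is harmless: nondegeneracy gives both existence and uniqueness of
the representing element. -/
theorem representative_eq (l : F →ₗ[ℂ] ℂ) : representative l = (pairingEquiv hF).symm l := by
  have h : ∀ v : F, pairing ((representative l : F) : H10 Ω N) (v : H10 Ω N) = l v :=
    Classical.epsilon_spec (p := fun g : F => ∀ v : F, pairing (g : H10 Ω N) (v : H10 Ω N) = l v)
      ⟨_, pairing_pairingEquiv_symm hF l⟩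
  exact eq_of_pairing_eq hF fun v => (h v).trans (pairing_pairingEquiv_symm hF l v).symm

/-- The operator `A` on `F` with `c ∫_Ω (A u) v = B(u, v)`. -/
def formOperator (c : ℂ) : (F →ₗ[ℂ] F →ₗ[ℂ] ℂ) →ₗ[ℂ] F →L[ℂ] F where
  toFun B := c⁻¹ • LinearMap.toContinuousLinearMap ((pairingEquiv hF).symm.toLinearMap ∘ₗ B)
  map_add' B B' := by rw [LinearMap.comp_add, map_add, smul_add]
  map_smul' d B := by rw [LinearMap.comp_smul, map_smul, smul_comm, RingHom.id_apply]

theorem smul_formOperator_apply {c : ℂ} (hc : c ≠ 0) (B : F →ₗ[ℂ] F →ₗ[ℂ] ℂ) (u : F) :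
    c • formOperator hF c B u = (pairingEquiv hF).symm (B u) := by
  change c • c⁻¹ • LinearMap.toContinuousLinearMap
    ((pairingEquiv hF).symm.toLinearMap ∘ₗ B) u = _
  rw [smul_inv_smul₀ hc]
  rfl

/-- The passage from the weak equation, tested against all v, to an explicit formula for the time
derivative. -/
theorem forall_pairing_eq_iff {c : ℂ} (hc : c ≠ 0) (B : F →ₗ[ℂ] F →ₗ[ℂ] ℂ) (u u' : F) :
    (∀ v : F, c * pairing (u' : H10 Ω N) (v : H10 Ω N) = B u v) ↔
      u' = formOperator hF c B u := by
  rw [← (smul_right_injective F hc).eq_iff]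
  simp only [smul_formOperator_apply hF hc]
  rw [LinearEquiv.eq_symm_apply, LinearMap.ext_iff]
  refine forall_congr' fun v => ?_
  rw [map_smul, LinearMap.smul_apply, pairing_eq_valForm]
  rfl

/-- The real-bilinear map `(f, g) ↦ A` with `c ∫_Ω (A u) v = ∫_Ω (Re(f̄ g) ∗ W) u v`. -/
def hartreeOperator (hΩ : MeasurableSet Ω) (hΩb : Bornology.IsBounded Ω) (c : ℂ) :
    BoundedBilin F F (F →L[ℂ] F) :=
  continuousBilin (X := F) (G := F →L[ℂ] F)
    ((hartreeForm F hΩ hΩb).compr₂ ((formOperator hF c).restrictScalars ℝ))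

theorem hartreeOperator_apply (hΩ : MeasurableSet Ω) (hΩb : Bornology.IsBounded Ω) (c : ℂ)
    (f g : F) : hartreeOperator hF hΩ hΩb c f g =
      formOperator hF c (hartreeForm F hΩ hΩb f g) := rfl

end Forms

/-! ### The fixed point map and its derivative -/

section FixedPointMap

variable {Ω : Set Space} {N : ℕ} {T : ℝ} (hT : 0 < T) {hbar : ℝ} (m : ℝ)
  {V : Space × ℝ → ℝ} {F : Submodule ℂ (H10 Ω N)} [FiniteDimensional ℂ F] (hΩ : MeasurableSet Ω)
  (hΩb : Bornology.IsBounded Ω) (h_hbar : 0 < hbar) (hV : IsC1OnClosure (Ω ×ˢ Ioo 0 T) V)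
  (hF : ∀ u : F, (∀ v : F, pairing (u : H10 Ω N) (v : H10 Ω N) = 0) → u = 0) (Ψ₀ : H10 Ω N)

/-- The part of the coefficient of the Faedo-Galerkin equation that is independent of `ψ`. -/
def linearCoeff (hbar : ℝ) : C(TimeInterval T, F →L[ℂ] F) where
  toFun t := formOperator hF (Complex.I * hbar)
    (kineticForm F (hbar ^ 2 / (2 * m)) + valForm F (memLp_top_potential hT hΩ hΩb hV t))
  continuous_toFun := by
    refine continuous_linearMap_comp_bilin (X := F) (Y := F →L[ℂ] F) (τ := TimeInterval T)
      (formOperator hF (Complex.I * hbar))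
      (B := fun t => kineticForm F (hbar ^ 2 / (2 * m)) +
        valForm F (memLp_top_potential hT hΩ hΩb hV t)) fun u v => ?_
    exact continuous_const.add (continuous_multiplierBilin_potential hT hΩ hΩb hV
      (valLinear Ω N u) (valLinear Ω N v))

/-- The coefficient `a` of the Faedo-Galerkin equation in the form `u' = a u`. -/
def galerkinCoeff (hbar : ℝ) (ψ : PathSpace T F) : C(TimeInterval T, F →L[ℂ] F) :=
  quadraticCoeff (E := F) (linearCoeff hT m hΩ hΩb hV hF hbar)
    (hartreeOperator hF hΩ hΩb (Complex.I * hbar)) ψ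

include h_hbar in
theorem I_mul_hbar_ne_zero : Complex.I * (hbar : ℂ) ≠ 0 :=
  mul_ne_zero Complex.I_ne_zero (Complex.ofReal_ne_zero.mpr h_hbar.ne')

include h_hbar in
-- The tested equation leaves exactly one candidate for the time derivative, so the existential
-- quantifier disappears and a linear ODE remains.
theorem solvesGalerkin_iff (ψ : PathSpace T F) (u : TimeInterval T → F) :
    SolvesGalerkin hT hbar m V ψ u ↔ ∀ t : TimeInterval T,
      HasDerivWithinAt (extend hT u) (galerkinCoeff hT m hΩ hΩb hV hF hbar ψ t (u t))
        (Icc 0 T) (t : ℝ) := by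
  refine forall_congr' fun t => ?_
  have e : galerkinCoeff hT m hΩ hΩb hV hF hbar ψ t = formOperator hF (Complex.I * hbar)
      (kineticForm F (hbar ^ 2 / (2 * m)) + valForm F (memLp_top_potential hT hΩ hΩb hV t) +
        hartreeForm F hΩ hΩb (ψ t) (ψ t)) := by
    rw [map_add (formOperator hF (Complex.I * hbar)) (_ + _)]
    rfl
  rw [e]
  simp only [galerkinForm_eq hT hΩ hΩb hbar m hV,
    forall_pairing_eq_iff hF (I_mul_hbar_ne_zero h_hbar)]
  exact exists_eq_right

include h_hbar in
theorem isGalerkinSolution_iff (ψ u : PathSpace T F) :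
    IsGalerkinSolution hT hbar m V Ψ₀ ψ u ↔
      u = solutionMap (E := F) hT (linearCoeff hT m hΩ hΩb hV hF hbar)
        (hartreeOperator hF hΩ hΩb (Complex.I * hbar)) (F.orthogonalProjectionOnto Ψ₀) ψ := by
  rw [IsGalerkinSolution, solvesGalerkin_iff hT m hΩ hΩb h_hbar hV hF, and_comm]
  exact (eq_solutionMap_iff hT _ _ _ ψ u).symm

include h_hbar in
theorem numericalMap_eq :
    numericalMap hT hbar m V Ψ₀ = solutionMap (E := F) hT (linearCoeff hT m hΩ hΩb hV hF hbar)
        (hartreeOperator hF hΩ hΩb (Complex.I * hbar)) (F.orthogonalProjectionOnto Ψ₀) := by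
  ext1 ψ
  rw [← isGalerkinSolution_iff hT m hΩ hΩb h_hbar hV hF]
  exact Classical.epsilon_spec (p := fun u => IsGalerkinSolution hT hbar m V Ψ₀ ψ u)
    ⟨_, (isGalerkinSolution_iff hT m hΩ hΩb h_hbar hV hF Ψ₀ ψ _).mpr rfl⟩

include h_hbar in
theorem isGalerkinEvolution_iff {ψ : PathSpace T F} {p q : C(TimeInterval T, F →L[ℂ] F)}
    (h : IsFundamentalPair (E := F) hT (galerkinCoeff hT m hΩ hΩb hV hF hbar ψ) p q)
    (U : TimeInterval T → TimeInterval T → F →L[ℂ] F) :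
    IsGalerkinEvolution hT hbar m V ψ U ↔ U = fun t s => p t * q s := by
  simp only [IsGalerkinEvolution, solvesGalerkin_iff hT m hΩ hΩb h_hbar hV hF]
  constructor
  · intro hU
    ext1 t
    ext1 s
    ext1 x
    have := h.eq_of_hasDerivWithinAt (hU s x).2 s t
    rwa [(hU s x).1] at this
  · rintro rfl s x
    exact ⟨h.apply_inv_apply s x, fun t => h.hasDerivWithinAt_apply (q s x) t⟩

include h_hbar in
theorem galerkinEvolution_eq {ψ : PathSpace T F} {p q : C(TimeInterval T, F →L[ℂ] F)}
    (h : IsFundamentalPair (E := F) hT (galerkinCoeff hT m hΩ hΩb hV hF hbar ψ) p q) :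
    galerkinEvolution hT hbar m V ψ = fun t s => p t * q s := by
  rw [← isGalerkinEvolution_iff hT m hΩ hΩb h_hbar hV hF h]
  exact Classical.epsilon_spec (p := fun U => IsGalerkinEvolution hT hbar m V ψ U)
    ⟨_, (isGalerkinEvolution_iff hT m hΩ hΩb h_hbar hV hF h _).mpr rfl⟩

include hΩ hΩb h_hbar hV hF in
-- Both sides solve the same equation with the same initial value. Thus the inner factor of the
-- formula is the solution u that occurs in the linearised equation.
theorem galerkinEvolution_startTime_apply (ψ : PathSpace T F) (s : TimeInterval T) :
    galerkinEvolution hT hbar m V ψ s (startTime hT) (F.orthogonalProjectionOnto Ψ₀) =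
      numericalMap hT hbar m V Ψ₀ ψ s := by
  obtain ⟨p, q, h⟩ := exists_isFundamentalPair (E := F) hT
    (galerkinCoeff hT m hΩ hΩb hV hF hbar ψ)
  have hs := (isGalerkinSolution_iff hT m hΩ hΩb h_hbar hV hF Ψ₀ ψ _).mpr
    (congrFun (numericalMap_eq hT m hΩ hΩb h_hbar hV hF Ψ₀) ψ)
  have := h.eq_of_hasDerivWithinAt
    ((solvesGalerkin_iff hT m hΩ hΩb h_hbar hV hF ψ _).mp hs.1) (startTime hT) s
  rw [galerkinEvolution_eq hT m hΩ hΩb h_hbar hV hF h, this, hs.2]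
  rfl

theorem hartreeFunctional_eq (ψ ω : PathSpace T F) (s : TimeInterval T) :
    hartreeFunctional hT hbar m V Ψ₀ ψ ω s = hartreeForm F hΩ hΩb (ψ s) (ω s)
      (galerkinEvolution hT hbar m V ψ s (startTime hT) (F.orthogonalProjectionOnto Ψ₀)) := rfl

include h_hbar in
-- The representing element is taken for the bare pairing, whereas the coefficient operator has iħ
-- divided out; hence the factor iħ.
theorem derivIntegrand_eq {ψ : PathSpace T F} {p q : C(TimeInterval T, F →L[ℂ] F)}
    (h : IsFundamentalPair (E := F) hT (galerkinCoeff hT m hΩ hΩb hV hF hbar ψ) p q)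
    (ω : PathSpace T F) (t s : TimeInterval T) :
    derivIntegrand hT hbar m V Ψ₀ ψ ω t s = (Complex.I * (hbar : ℂ)) •
      p t (q s (hartreeOperator hF hΩ hΩb (Complex.I * hbar) (ψ s) (ω s)
        (numericalMap hT hbar m V Ψ₀ ψ s))) := by
  rw [← map_smul, ← map_smul, hartreeOperator_apply,
    smul_formOperator_apply hF (I_mul_hbar_ne_zero h_hbar), derivIntegrand,
    hartreeFunctional_eq hT m hΩ hΩb, representative_eq hF,
    galerkinEvolution_startTime_apply hT m hΩ hΩb h_hbar hV hF,
    galerkinEvolution_eq hT m hΩ hΩb h_hbar hV hF h]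
  rfl

include hΩ hΩb h_hbar hV hF in
theorem intervalIntegrable_derivIntegrand (ψ ω : PathSpace T F) (t : TimeInterval T) (a b : ℝ) :
    IntervalIntegrable
      (fun s : ℝ => derivIntegrand hT hbar m V Ψ₀ ψ ω t (projIcc 0 T hT.le s)) volume a b := by
  obtain ⟨p, q, h⟩ := exists_isFundamentalPair (E := F) hT
    (galerkinCoeff hT m hΩ hΩb hV hF hbar ψ)
  refine Continuous.intervalIntegrable ?_ _ _
  refine Continuous.comp (g := fun s => derivIntegrand hT hbar m V Ψ₀ ψ ω t s) ?_
    continuous_projIcc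
  simp only [derivIntegrand_eq hT m hΩ hΩb h_hbar hV hF Ψ₀ h]
  fun_prop

include hΩ hΩb h_hbar hV hF in
theorem contDiff_numericalMap :
    ContDiff ℝ 1 (numericalMap hT hbar m V Ψ₀ : PathSpace T F → PathSpace T F) := by
  rw [numericalMap_eq hT m hΩ hΩb h_hbar hV hF Ψ₀]
  exact contDiff_solutionMap (E := F) hT _ _ _

include hΩ hΩb h_hbar hV hF in
theorem fderiv_numericalMap_apply (ψ ω : PathSpace T F) (t : TimeInterval T) :
    fderiv ℝ (numericalMap hT hbar m V Ψ₀) ψ ω t = (-(2 * Complex.I / (hbar : ℂ))) •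
      ∫ s in (0 : ℝ)..t, derivIntegrand hT hbar m V Ψ₀ ψ ω t (projIcc 0 T hT.le s) := by
  obtain ⟨p, q, h⟩ := exists_isFundamentalPair (E := F) hT
    (galerkinCoeff hT m hΩ hΩb hV hF hbar ψ)
  -- The prefactor of the formula cancels the iħ of the integrand and leaves the 2 of the product
  -- rule.
  have hc : -(2 * Complex.I / (hbar : ℂ)) * (Complex.I * hbar) = 2 := by
    have : (hbar : ℂ) ≠ 0 := Complex.ofReal_ne_zero.mpr h_hbar.ne'
    field_simp
    simp
  simp only [derivIntegrand_eq hT m hΩ hΩb h_hbar hV hF Ψ₀ h]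
  rw [intervalIntegral.integral_smul, smul_smul, hc,
    numericalMap_eq hT m hΩ hΩb h_hbar hV hF Ψ₀]
  exact fderiv_solutionMap_apply (E := F) hT _ _
    (fun f g => by rw [hartreeOperator_apply, hartreeForm_comm, hartreeOperator_apply]) h ω t

end FixedPointMap

end Galerkin

end

theorem mainTheorem4 (N : ℕ) (Ω : Set Galerkin.Space) (hΩ : IsOpen Ω)
    (hΩb : Bornology.IsBounded Ω) (T : ℝ) (hT : 0 < T) (hbar m : ℝ) (h_hbar : 0 < hbar)
    (hm : 0 < m) (V : Galerkin.Space × ℝ → ℝ)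
    (hV : Galerkin.IsC1OnClosure (Ω ×ˢ Set.Ioo 0 T) V)
    (Ψ₀ : Galerkin.H10 Ω N) (F : Submodule ℂ (Galerkin.H10 Ω N)) [FiniteDimensional ℂ F]
    (hF : ∀ u : F, (∀ v : F,
      Galerkin.pairing (u : Galerkin.H10 Ω N) (v : Galerkin.H10 Ω N) = 0) → u = 0) :
    -- the evolution operators exist and are unique
    (∀ (ψ : Galerkin.PathSpace T F)
        (U : Galerkin.TimeInterval T → Galerkin.TimeInterval T → F →L[ℂ] F),
      Galerkin.IsGalerkinEvolution hT hbar m V ψ U ↔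
        U = Galerkin.galerkinEvolution hT hbar m V ψ) ∧
    -- the numerical fixed point map is well defined
    (∀ ψ u : Galerkin.PathSpace T F,
      Galerkin.IsGalerkinSolution hT hbar m V Ψ₀ ψ u ↔
        u = Galerkin.numericalMap hT hbar m V Ψ₀ ψ) ∧
    -- the Hartree term in the formula has its representative in `F`
    (∀ (ψ ω : Galerkin.PathSpace T F) (s : Galerkin.TimeInterval T) (v : F),
      Galerkin.pairing
          (Galerkin.representative (Galerkin.hartreeFunctional hT hbar m V Ψ₀ ψ ω s) : F)
          (v : Galerkin.H10 Ω N) =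
        Galerkin.hartreeFunctional hT hbar m V Ψ₀ ψ ω s v) ∧
    -- the derivative, its formula and its continuity
    ∃ K' : Galerkin.PathSpace T F → (Galerkin.PathSpace T F →L[ℝ] Galerkin.PathSpace T F),
      (∀ ψ ω : Galerkin.PathSpace T F,
        HasLineDerivAt ℝ (Galerkin.numericalMap hT hbar m V Ψ₀) (K' ψ ω) ψ ω) ∧
      (∀ (ψ ω : Galerkin.PathSpace T F) (t : Galerkin.TimeInterval T),
        IntervalIntegrable
          (fun s : ℝ => Galerkin.derivIntegrand hT hbar m V Ψ₀ ψ ω t (Set.projIcc 0 T hT.le s))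
          MeasureTheory.volume 0 t ∧
        K' ψ ω t = (-(2 * Complex.I / (hbar : ℂ))) •
          ∫ s in (0 : ℝ)..t,
            Galerkin.derivIntegrand hT hbar m V Ψ₀ ψ ω t (Set.projIcc 0 T hT.le s)) ∧
      Continuous K' ∧
      ∀ ψ : Galerkin.PathSpace T F,
        HasFDerivAt (Galerkin.numericalMap hT hbar m V Ψ₀) (K' ψ) ψ := by
  have hΩm := hΩ.measurableSet
  have hK := Galerkin.contDiff_numericalMap hT m hΩm hΩb h_hbar hV hF Ψ₀
  have hd : ∀ ψ : Galerkin.PathSpace T F, HasFDerivAt (Galerkin.numericalMap hT hbar m V Ψ₀)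
      (fderiv ℝ (Galerkin.numericalMap hT hbar m V Ψ₀) ψ) ψ := fun ψ =>
    (hK.differentiable one_ne_zero ψ).hasFDerivAt
  refine ⟨fun ψ U => ?_, fun ψ u => ?_, fun ψ ω s v => ?_,
    fderiv ℝ (Galerkin.numericalMap hT hbar m V Ψ₀), fun ψ ω => (hd ψ).hasLineDerivAt ω,
    fun ψ ω t => ⟨?_, ?_⟩, hK.continuous_fderiv one_ne_zero, hd⟩
  · obtain ⟨p, q, h⟩ := Galerkin.exists_isFundamentalPair (E := F) hT
      (Galerkin.galerkinCoeff hT m hΩm hΩb hV hF hbar ψ)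
    rw [Galerkin.isGalerkinEvolution_iff hT m hΩm hΩb h_hbar hV hF h,
      Galerkin.galerkinEvolution_eq hT m hΩm hΩb h_hbar hV hF h]
  · rw [Galerkin.isGalerkinSolution_iff hT m hΩm hΩb h_hbar hV hF,
      Galerkin.numericalMap_eq hT m hΩm hΩb h_hbar hV hF Ψ₀]
  · rw [Galerkin.hartreeFunctional_eq hT m hΩm hΩb, Galerkin.representative_eq hF]
    exact Galerkin.pairing_pairingEquiv_symm hF _ v
  · exact Galerkin.intervalIntegrable_derivIntegrand hT m hΩm hΩb h_hbar hV hF Ψ₀ ψ ω t 0 t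
  · exact Galerkin.fderiv_numericalMap_apply hT m hΩm hΩb h_hbar hV hF Ψ₀ ψ ω t
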